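/- Let $V$ be a finite-dimensional real vector space with dual $V^*$, let $\Delta=\{a_1,\dots,a_l\}\subset V$ and $\Delta^\vee=\{a_1^\vee,\dots,a_l^\vee\}\subset V^*$ be linearly independent and form a Kac-Moody root system: $\langle a_i,a_i^\vee\rangle=2$; $\langle a_i,a_j^\vee\rangle\in\mathbb Z_{\le 0}$ for $i\ne j$; and $\langle a_i,a_j^\vee\rangle=0$ implies $\langle a_j,a_i^\vee\rangle=0$. Let $W\subset GL(V)$ be the Weyl group, generated by the reflections $s_i(v)=v-\langle v,a_i^\vee\rangle a_i$, acting on $V^*$ by $\langle v,wl\rangle=\langle w^{-1}v,l\rangle$, with word length $\ell$. Let $\Phi_{re,+}$ be the set of positive real roots, i.e. the elements $b=wa_i$ ($w\in W$) which are $\mathbb Z_{\ge0}$-combinations of simple roots; the coroot of $b=wa_i$ is $b^\vee=wa_i^\vee$. Put $\Phi(w)=\{b\in\Phi_{re,+}: -w^{-1}b\in\Phi_{re,+}\}$ and $C=\{y\in V:\langle y,a_i^\vee\rangle>0\ \forall i\}$, and let $W\cdot C=\bigcup_{w\in W}wC$. Let $r\in[0,\infty]$ be the radius of convergence of the Poincaré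 series $W(t)=\sum_{w\in W}t^{\ell(w)}$ and $D_r=\{t\in\mathbb C:|t|<r\}$. On $V\otimes\mathbb C=V+iV$ extend $\langle\cdot,l\rangle$ and the action of $W$ complex-linearly. Let $$P_w(t,h)=\prod_{a\in\Phi_{re,+}}\frac{1-te^{2\pi i\langle h,wa^\vee\rangle}}{1-e^{2\pi i\langle h,wa^\vee\rangle}},\qquad S(t,h)=\sum_{w\in W}P_w(t,h),$$ $$\mathcal C(t,h)=\Bigl(\sum_{w\in W}\prod_{b\in\Phi(w)}\frac{t-e^{2\pi i\langle h,b^\vee\rangle}}{1-te^{2\pi i\langle h,b^\vee\rangle}}\Bigr)\Bigl(\prod_{b\in\Phi_{re,+}}\frac{1-te^{2\pi i\langle h,b^\vee\rangle}}{1-e^{2\pi i\langle h,b^\vee\rangle}}\Bigr).$$ Then: (1) $D_r\times(V+iW\cdot C)$ is open, and $e^{2\pi i\langle h,wa^\vee\rangle}\neq1$ for all $h\in V+iW\cdot C$, $w\in W$, $a\in\Phi_{re,+}$. (2) For each $w\in W$ the product $P_w$ converges absolutely, uniformly on compact subsets of $D_r\times(V+iW\cdot C)$: the sum over $a$ of the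 absolute values of (factor minus $1$) converges uniformly there. The sum $\sum_{w\in W}|P_w(t,h)|$ converges uniformly on compact subsets of $D_r\times(V+iW\cdot C)$. (3) If $(t,h)\in D_r\times(V+iW\cdot C)$ and $te^{2\pi i\langle h,b^\vee\rangle}\ne1$ for all $b\in\Phi_{re,+}$ (so that no denominator in $\mathcal C(t,h)$ vanishes), then every $\Phi(w)$ is finite, the sum over $W$ in $\mathcal C(t,h)$ converges absolutely, and $S(t,h)=\mathcal C(t,h)$. The condition holds for all $t\in D_r$, $h\in V+iC$ if $W$ is infinite, and for all $t\in D_r$ with $|t|<1$, $h\in V+iC$ in any case. (4) $S$ is a holomorphic function on $D_r\times(V+iW\cdot C)$. It is $W$-invariant: for $t\in D_r$, $h\in V+iW\cdot C$ and $w\in W$ we have $wh\in V+iW\cdot C$ and $S(t,wh)=S(t,h)$. -/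

import Mathlib

noncomputable section

/-! ### The complexification `V ⊗ ℂ = V + iV` of a real normed space -/

/-- The complexification `V + iV`: the element `⟨x, y⟩` is `x + iy`. -/
@[ext]
structure Complexification (V : Type*) where
  /-- the real part `x` of `x + iy` -/
  re : V
  /-- the imaginary part `y` of `x + iy` -/
  im : V

namespace Complexification

section Algebra

variable {V : Type*} [AddCommGroup V]

instance : Zero (Complexification V) := ⟨⟨0, 0⟩⟩
instance : Add (Complexification V) := ⟨fun z z' => ⟨z.re + z'.re, z.im + z'.im⟩⟩
instance : Neg (Complexification V) := ⟨fun z => ⟨-z.re, -z.im⟩⟩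

@[simp] theorem zero_re : (0 : Complexification V).re = 0 := rfl
@[simp] theorem zero_im : (0 : Complexification V).im = 0 := rfl
@[simp] theorem add_re (z z' : Complexification V) : (z + z').re = z.re + z'.re := rfl
@[simp] theorem add_im (z z' : Complexification V) : (z + z').im = z.im + z'.im := rfl
@[simp] theorem neg_re (z : Complexification V) : (-z).re = -z.re := rfl
@[simp] theorem neg_im (z : Complexification V) : (-z).im = -z.im := rfl

instance : AddCommGroup (Complexification V) where
  add_assoc _ _ _ := by ext <;> simp [add_assoc]
  zero_add _ := by ext <;> simp
  add_zero _ := by ext <;> simp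
  neg_add_cancel _ := by ext <;> simp
  add_comm _ _ := by ext <;> simp [add_comm]
  nsmul := nsmulRec
  zsmul := zsmulRec

variable [Module ℝ V]

/-- `(a + ib)(x + iy) = (ax - by) + i(ay + bx)`. -/
instance : SMul ℂ (Complexification V) :=
  ⟨fun c z => ⟨c.re • z.re - c.im • z.im, c.re • z.im + c.im • z.re⟩⟩

@[simp] theorem smul_re (c : ℂ) (z : Complexification V) :
    (c • z).re = c.re • z.re - c.im • z.im := rfl
@[simp] theorem smul_im (c : ℂ) (z : Complexification V) :
    (c • z).im = c.re • z.im + c.im • z.re := rfl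

instance : Module ℂ (Complexification V) where
  one_smul _ := by ext <;> simp
  mul_smul _ _ _ := by ext <;> simp <;> module
  smul_zero _ := by ext <;> simp
  smul_add _ _ _ := by ext <;> simp <;> module
  add_smul _ _ _ := by ext <;> simp <;> module
  zero_smul _ := by ext <;> simp

/-- The complex-linear extension `⟨x + iy, l⟩ = l(x) + i l(y)` of a real linear form `l`. -/
def pairing (z : Complexification V) (l : Module.Dual ℝ V) : ℂ :=
  (l z.re : ℂ) + Complex.I * (l z.im : ℂ)

/-- The complex-linear extension `g(x + iy) = gx + i gy` of a real linear automorphism `g`. -/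
def map (g : V ≃ₗ[ℝ] V) (z : Complexification V) : Complexification V :=
  ⟨g z.re, g z.im⟩

end Algebra

section Norm

variable {V : Type*} [NormedAddCommGroup V] [NormedSpace ℝ V]

/-- `V + iV` as a space of real linear maps from the dual of `V` to `ℂ`: `z ↦ (l ↦ ⟨z, l⟩)`. -/
def toDualMap : Complexification V →ₗ[ℂ] (StrongDual ℝ V →L[ℝ] ℂ) where
  toFun z :=
    Complex.ofRealCLM.comp (ContinuousLinearMap.apply ℝ ℝ z.re) +
      Complex.I • Complex.ofRealCLM.comp (ContinuousLinearMap.apply ℝ ℝ z.im)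
  map_add' z z' := by
    ext l
    simp
    ring
  map_smul' c z := by
    ext l
    apply Complex.ext <;> simp <;> ring

theorem toDualMap_apply (z : Complexification V) (l : StrongDual ℝ V) :
    toDualMap z l = (l z.re : ℂ) + Complex.I * (l z.im : ℂ) := rfl

theorem toDualMap_injective : Function.Injective (toDualMap (V := V)) := by
  intro z z' h
  have key : ∀ l : StrongDual ℝ V, l z.re = l z'.re ∧ l z.im = l z'.im := by
    intro l
    have h1 := congrArg (fun F => F l) h
    simp only [toDualMap_apply] at h1
    exact ⟨by simpa using congrArg Complex.re h1, by simpa using congrArg Complex.im h1⟩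
  ext
  · exact (SeparatingDual.eq_iff_forall_dual_eq (R := ℝ)).2 fun l => (key l).1
  · exact (SeparatingDual.eq_iff_forall_dual_eq (R := ℝ)).2 fun l => (key l).2

/-- The norm `‖x + iy‖ = sup_{‖l‖ ≤ 1} |l(x) + i l(y)|`; it is complex-homogeneous and equivalent to
the product norm, see `norm_re_le`, `norm_im_le` and `norm_le_add`. -/
instance : NormedAddCommGroup (Complexification V) :=
  NormedAddCommGroup.induced (Complexification V) (StrongDual ℝ V →L[ℝ] ℂ) toDualMap
    toDualMap_injective

instance : NormedSpace ℂ (Complexification V) :=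
  NormedSpace.induced ℂ (Complexification V) (StrongDual ℝ V →L[ℝ] ℂ) toDualMap

theorem norm_def (z : Complexification V) : ‖z‖ = ‖toDualMap z‖ := rfl

theorem norm_re_le (z : Complexification V) : ‖z.re‖ ≤ ‖z‖ := by
  refine NormedSpace.norm_le_dual_bound ℝ z.re (norm_nonneg z) fun l => ?_
  have h1 : ‖toDualMap z l‖ ≤ ‖z‖ * ‖l‖ := (toDualMap z).le_opNorm l
  refine le_trans ?_ h1
  have h2 := Complex.abs_re_le_norm (toDualMap z l)
  simpa [toDualMap_apply] using h2

theorem norm_im_le (z : Complexification V) : ‖z.im‖ ≤ ‖z‖ := by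
  refine NormedSpace.norm_le_dual_bound ℝ z.im (norm_nonneg z) fun l => ?_
  have h1 : ‖toDualMap z l‖ ≤ ‖z‖ * ‖l‖ := (toDualMap z).le_opNorm l
  refine le_trans ?_ h1
  have h2 := Complex.abs_im_le_norm (toDualMap z l)
  simpa [toDualMap_apply] using h2

theorem norm_le_add (z : Complexification V) : ‖z‖ ≤ ‖z.re‖ + ‖z.im‖ := by
  refine ContinuousLinearMap.opNorm_le_bound _ (by positivity) fun l => ?_
  rw [toDualMap_apply]
  refine (norm_add_le _ _).trans ?_
  have h1 := l.le_opNorm z.re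
  have h2 := l.le_opNorm z.im
  simp only [norm_mul, Complex.norm_I, one_mul, Complex.norm_real]
  linarith

end Norm

end Complexification

/-! ### Kac-Moody root systems -/

/-- A Kac-Moody root system `(V, Δ, V*, Δ^∨)` with simple roots `a_i` and simple coroots `a_i^∨`,
`i ∈ ι`. (For finite-dimensional `V` the index type `ι` is finite by linear independence.) -/
structure KacMoodyRootSystem (ι V : Type*) [AddCommGroup V] [Module ℝ V] where
  /-- the simple roots -/
  simpleRoot : ι → V
  /-- the simple coroots -/
  simpleCoroot : ι → Module.Dual ℝ V
  linearIndependent_simpleRoot : LinearIndependent ℝ simpleRoot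
  linearIndependent_simpleCoroot : LinearIndependent ℝ simpleCoroot
  pairing_self : ∀ i, simpleCoroot i (simpleRoot i) = 2
  pairing_nonpos : ∀ i j, i ≠ j → ∃ n : ℤ, n ≤ 0 ∧ simpleCoroot j (simpleRoot i) = n
  pairing_eq_zero : ∀ i j, simpleCoroot j (simpleRoot i) = 0 → simpleCoroot i (simpleRoot j) = 0

namespace KacMoodyRootSystem

section Algebra

variable {ι V : Type*} [AddCommGroup V] [Module ℝ V] (R : KacMoodyRootSystem ι V)

/-- The fundamental reflection `s_i(v) = v - ⟨v, a_i^∨⟩ a_i`. -/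
def simpleReflection (i : ι) : V ≃ₗ[ℝ] V :=
  Module.reflection (R.pairing_self i)

/-- The Weyl group. -/
def weylGroup : Subgroup (V ≃ₗ[ℝ] V) :=
  Subgroup.closure (Set.range R.simpleReflection)

/-- The length of `w`: the least number of factors in an expression of `w` as a product of
fundamental reflections. -/
def length (w : R.weylGroup) : ℕ :=
  sInf {n | ∃ L : List ι, L.length = n ∧ (L.map R.simpleReflection).prod = (w : V ≃ₗ[ℝ] V)}

/-- The action of the Weyl group on the dual space, `⟨v, w l⟩ = ⟨w⁻¹ v, l⟩`. -/
def dualAct (w : R.weylGroup) (l : Module.Dual ℝ V) : Module.Dual ℝ V :=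
  l ∘ₗ ((w⁻¹ : R.weylGroup) : V ≃ₗ[ℝ] V).toLinearMap

/-- The real roots: the Weyl group conjugates of the simple roots. -/
def realRoots : Set V :=
  {b | ∃ (w : R.weylGroup) (i : ι), b = (w : V ≃ₗ[ℝ] V) (R.simpleRoot i)}

/-- The positive real roots: the real roots that are combinations of simple roots with
nonnegative integer coefficients. -/
def posRealRoots : Set V :=
  {b | b ∈ R.realRoots ∧ b ∈ AddSubmonoid.closure (Set.range R.simpleRoot)}

open Classical in
/-- The coroot `b^∨ = w a_i^∨` of a real root `b = w a_i` (which does not depend on the choice of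
`w` and `i`). -/
def coroot (b : V) : Module.Dual ℝ V :=
  if hb : b ∈ R.realRoots then
    R.dualAct hb.choose (R.simpleCoroot hb.choose_spec.choose)
  else 0

/-- `Φ(w)`, the set of positive real roots `b` with `w⁻¹ b < 0`. -/
def inversions (w : R.weylGroup) : Set V :=
  {b | b ∈ R.posRealRoots ∧ -(((w⁻¹ : R.weylGroup) : V ≃ₗ[ℝ] V) b) ∈ R.posRealRoots}

/-- The open dominant chamber `C`. -/
def chamber : Set V := {y | ∀ i, 0 < R.simpleCoroot i y}

/-- `W · C`, the union of the Weyl group translates of the dominant chamber. -/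
def chamberTranslates : Set V :=
  ⋃ w : R.weylGroup, (w : V ≃ₗ[ℝ] V) '' R.chamber

/-- The tube `V + i (W · C)`. -/
def tube : Set (Complexification V) := {h | h.im ∈ R.chamberTranslates}

/-- The Poincaré series `W(t) = ∑_{w ∈ W} t^{ℓ(w)} = ∑_n #{w | ℓ(w) = n} t^n`. -/
def poincareSeries : FormalMultilinearSeries ℂ ℂ ℂ :=
  FormalMultilinearSeries.ofScalars ℂ
    (fun n : ℕ => (Nat.card {w : R.weylGroup // R.length w = n} : ℂ))

/-- The open disk `D_r`, where `r ∈ [0, ∞]` is the radius of convergence of `W(t)`. -/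
def disk : Set ℂ := Metric.eball 0 R.poincareSeries.radius

/-- `e^{2πi⟨h, l⟩}`. -/
def expPairing (h : Complexification V) (l : Module.Dual ℝ V) : ℂ :=
  Complex.exp (2 * Real.pi * Complex.I * h.pairing l)

/-- The factor `(1 - t e^{2πi⟨h, l⟩}) / (1 - e^{2πi⟨h, l⟩})`. -/
def factor (t : ℂ) (h : Complexification V) (l : Module.Dual ℝ V) : ℂ :=
  (1 - t * expPairing h l) / (1 - expPairing h l)

/-- The product `∏_{a > 0} (1 - t e^{2πi⟨h, w a^∨⟩}) / (1 - e^{2πi⟨h, w a^∨⟩})` over the positive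
real roots. -/
def weylTerm (w : R.weylGroup) (t : ℂ) (h : Complexification V) : ℂ :=
  ∏' a : R.posRealRoots, factor t h (R.dualAct w (R.coroot a))

/-- The sum `∑_{w ∈ W} ∏_{a > 0} (1 - t e^{2πi⟨h, w a^∨⟩}) / (1 - e^{2πi⟨h, w a^∨⟩})`. -/
def weylSum (t : ℂ) (h : Complexification V) : ℂ :=
  ∑' w : R.weylGroup, R.weylTerm w t h

/-- The product `∏_{b ∈ Φ(w)} (t - e^{2πi⟨h, b^∨⟩}) / (1 - t e^{2πi⟨h, b^∨⟩})`. -/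
def inversionTerm (w : R.weylGroup) (t : ℂ) (h : Complexification V) : ℂ :=
  ∏ᶠ b ∈ R.inversions w,
    (t - expPairing h (R.coroot b)) / (1 - t * expPairing h (R.coroot b))

/-- The function `𝒞(t, h)` in its factored form, the product of
`∑_{w ∈ W} ∏_{b ∈ Φ(w)} (t - e^{2πi⟨h, b^∨⟩}) / (1 - t e^{2πi⟨h, b^∨⟩})` and
`∏_{b > 0} (1 - t e^{2πi⟨h, b^∨⟩}) / (1 - e^{2πi⟨h, b^∨⟩})`. -/
def correction (t : ℂ) (h : Complexification V) : ℂ :=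
  (∑' w : R.weylGroup, R.inversionTerm w t h) *
    ∏' b : R.posRealRoots, factor t h (R.coroot b)

end Algebra

end KacMoodyRootSystem

end

/-!
The theorem rests on one estimate. Let `y = Im h` lie in the dominant chamber `C`, with
`⟨y, a_i^∨⟩ ≥ δ > 0` for all `i`, and let `|t| ≤ ρ`. Coroots of positive roots are nonzero
combinations of simple coroots with coefficients in `ℕ`, and a root is determined by its coroot.
Hence `|e^{2πi⟨h, b^∨⟩}| ≤ x_b := e^{-2πδ ht(b^∨)}`, and `∑ x_b` converges, being part of a product
of geometric series (`summable_rootBound`). Passing from `Φ₊` to `w Φ₊` replaces the inversions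
`b ∈ Φ(w)` by `-b`, so `P_w` is a product over `b ∈ Φ₊` with factor
`(1 - t e^b) / (1 - e^b) = 1 + O(x_b)` if `b ∉ Φ(w)`, and
`(t - e^b) / (1 - e^b) = O(ρ (1 + O(x_b)))` if `b ∈ Φ(w)`, where `e^b` stands for
`e^{2πi⟨h, b^∨⟩}` (`weylTerm_eq_tprod_signedFactor`, `exists_signedFactor_bound`). As `Φ(w)` has
`ℓ(w)` elements, `|P_w| ≤ K ρ^{ℓ(w)}` with `K` independent of `w`, and `∑_w ρ^{ℓ(w)}` is the
Poincaré series, which converges for `ρ < r`. Over `u C` the same bounds hold with `w` replaced by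
`u⁻¹ w`, because `P_w(t, u h) = P_{u⁻¹ w}(t, h)` (`weylTerm_map`); this identity also gives the
invariance of the sum. Dividing `P_w` by the common product over `Φ₊`, which does not vanish,
yields the factored form (`weylTerm_eq_inversionTerm_mul`). Holomorphy follows from a version of
Weierstrass' theorem in several variables. If `W` is infinite, its Poincaré series diverges at `1`,
so that `|t| < 1` on `D_r`.

The facts on root systems behind this are: a real root `w a_i` is positive or negative according to
whether `s_i` lengthens or shortens `w` (`act_simpleRoot_mem_posCone`, an induction on the length
which reduces to the dihedral groups generated by two reflections); applied to the dual system,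
this shows that roots and coroots are positive simultaneously; `w a_i = a_j` implies
`w s_i w⁻¹ = s_j` (`gen_mul_eq_mul_gen`), so coroots are well defined and determine their roots; and
`Φ(w s_i) = Φ(w) ∪ {w a_i}` if `s_i` lengthens `w`, so that `Φ(w)` has `ℓ(w)` elements.
-/

noncomputable section

namespace KacMoodyRootSystem

/-! ### Words and lengths in the Weyl group -/

section Words

variable {ι V : Type*} [AddCommGroup V] [Module ℝ V] (R : KacMoodyRootSystem ι V)

/-- The fundamental reflection `s_i` as an element of the Weyl group. -/
def gen (i : ι) : R.weylGroup :=
  ⟨R.simpleReflection i, Subgroup.subset_closure (Set.mem_range_self i)⟩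

/-- The linear action of a Weyl group element on `V`. -/
def act (w : R.weylGroup) : V ≃ₗ[ℝ] V := w

theorem act_mul (w w' : R.weylGroup) (v : V) : R.act (w * w') v = R.act w (R.act w' v) := rfl

@[simp] theorem act_one (v : V) : R.act 1 v = v := rfl

theorem act_inv_act (w : R.weylGroup) (v : V) : R.act w⁻¹ (R.act w v) = v := by
  rw [← act_mul, inv_mul_cancel, act_one]

theorem act_act_inv (w : R.weylGroup) (v : V) : R.act w (R.act w⁻¹ v) = v := by
  rw [← act_mul, mul_inv_cancel, act_one]

theorem act_ext {w w' : R.weylGroup} (h : ∀ v, R.act w v = R.act w' v) : w = w' :=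
  Subtype.ext (LinearEquiv.ext h)

theorem act_gen (i : ι) (v : V) :
    R.act (R.gen i) v = v - R.simpleCoroot i v • R.simpleRoot i := by
  simp [act, gen, simpleReflection, Module.reflection_apply]

theorem act_gen_self (i : ι) : R.act (R.gen i) (R.simpleRoot i) = -R.simpleRoot i := by
  rw [act_gen, R.pairing_self, two_smul]
  abel

theorem gen_mul_gen (i : ι) : R.gen i * R.gen i = 1 := by
  apply R.act_ext
  intro v
  rw [act_mul, R.act_gen i v, map_sub, map_smul, act_gen_self, act_gen, act_one]
  module

theorem gen_inv (i : ι) : (R.gen i)⁻¹ = R.gen i :=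
  inv_eq_of_mul_eq_one_left (R.gen_mul_gen i)

theorem simpleRoot_ne_zero (i : ι) : R.simpleRoot i ≠ 0 :=
  R.linearIndependent_simpleRoot.ne_zero i

theorem coe_prod_gen (L : List ι) :
    (((L.map R.gen).prod : R.weylGroup) : V ≃ₗ[ℝ] V) = (L.map R.simpleReflection).prod := by
  induction L with
  | nil => rfl
  | cons i L ih => rw [List.map_cons, List.prod_cons, Subgroup.coe_mul, ih]; rfl

theorem exists_prod_gen (w : R.weylGroup) : ∃ L : List ι, (L.map R.gen).prod = w := by
  obtain ⟨g, hg⟩ := w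
  have : ∃ L : List ι, (L.map R.simpleReflection).prod = g := by
    induction hg using Subgroup.closure_induction with
    | mem x hx => obtain ⟨i, rfl⟩ := hx; exact ⟨[i], by simp⟩
    | one => exact ⟨[], rfl⟩
    | mul x y _ _ hx hy =>
      obtain ⟨L, rfl⟩ := hx
      obtain ⟨L', rfl⟩ := hy
      exact ⟨L ++ L', by simp⟩
    | inv x _ hx =>
      obtain ⟨L, rfl⟩ := hx
      refine ⟨L.reverse, ?_⟩
      rw [List.prod_inv_reverse, List.map_reverse]
      congr 2
      simp only [List.map_map]
      rfl
  obtain ⟨L, hL⟩ := this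
  exact ⟨L, Subtype.ext ((R.coe_prod_gen L).trans hL)⟩

theorem length_prod_gen_le (L : List ι) : R.length (L.map R.gen).prod ≤ L.length :=
  Nat.sInf_le ⟨L, rfl, (R.coe_prod_gen L).symm⟩

theorem exists_reduced_word (w : R.weylGroup) :
    ∃ L : List ι, L.length = R.length w ∧ (L.map R.gen).prod = w := by
  have hne : {n | ∃ L : List ι, L.length = n ∧
      (L.map R.simpleReflection).prod = (w : V ≃ₗ[ℝ] V)}.Nonempty := by
    obtain ⟨L, hL⟩ := R.exists_prod_gen w
    exact ⟨_, L, rfl, by rw [← coe_prod_gen, hL]⟩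
  obtain ⟨L, h1, h2⟩ := Nat.sInf_mem hne
  exact ⟨L, h1, Subtype.ext ((R.coe_prod_gen L).trans h2)⟩

theorem length_one : R.length 1 = 0 := Nat.le_zero.1 (R.length_prod_gen_le [])

theorem length_mul_le (w w' : R.weylGroup) : R.length (w * w') ≤ R.length w + R.length w' := by
  obtain ⟨L, h1, h2⟩ := R.exists_reduced_word w
  obtain ⟨L', h1', h2'⟩ := R.exists_reduced_word w'
  have := R.length_prod_gen_le (L ++ L')
  rwa [List.map_append, List.prod_append, h2, h2', List.length_append, h1, h1'] at this

theorem length_gen_le (i : ι) : R.length (R.gen i) ≤ 1 := by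
  simpa using R.length_prod_gen_le [i]

theorem length_mul_gen_le (w : R.weylGroup) (i : ι) : R.length (w * R.gen i) ≤ R.length w + 1 :=
  (R.length_mul_le _ _).trans (Nat.add_le_add_left (R.length_gen_le i) _)

theorem mul_gen_mul_gen (w : R.weylGroup) (i : ι) : w * R.gen i * R.gen i = w := by
  rw [mul_assoc, gen_mul_gen, mul_one]

theorem length_le_length_mul_gen (w : R.weylGroup) (i : ι) :
    R.length w ≤ R.length (w * R.gen i) + 1 := by
  simpa only [mul_gen_mul_gen] using R.length_mul_gen_le (w * R.gen i) i

/-- An element other than `1` can be shortened by a fundamental reflection on the right. -/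
theorem exists_length_mul_gen_lt {w : R.weylGroup} (hw : w ≠ 1) :
    ∃ i, R.length (w * R.gen i) < R.length w := by
  obtain ⟨L, h1, h2⟩ := R.exists_reduced_word w
  obtain rfl | ⟨L', i, rfl⟩ := List.eq_nil_or_concat' L
  · exact absurd h2.symm hw
  · refine ⟨i, ?_⟩
    have := R.length_prod_gen_le L'
    rw [← h1, ← h2]
    simp only [List.map_append, List.map_cons, List.map_nil, List.prod_append, List.prod_singleton,
      mul_gen_mul_gen, List.length_append, List.length_singleton]
    exact Nat.lt_succ_of_le this

end Words

/-! ### Pairs of simple reflections -/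

section RankTwo

variable {ι V : Type*} [AddCommGroup V] [Module ℝ V] (R : KacMoodyRootSystem ι V)

/-- The alternating product `⋯ s_j s_i s_j` with `k` factors, of which the rightmost is `s_j`. -/
def alt (i j : ι) : ℕ → R.weylGroup
  | 0 => 1
  | k + 1 => alt j i k * R.gen j

theorem act_alt_succ (i j : ι) (k : ℕ) (v : V) :
    R.act (R.alt i j (k + 1)) v = R.act (R.alt j i k) (R.act (R.gen j) v) := rfl

/-- Alternating products grow by one letter on the left, and successive such letters differ. -/
theorem alt_succ_left (i j : ι) (k : ℕ) : ∃ x y, (x = i ∧ y = j ∨ x = j ∧ y = i) ∧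
    R.alt i j (k + 1) = R.gen x * R.alt i j k ∧
    R.alt i j (k + 2) = R.gen y * R.alt i j (k + 1) := by
  induction k generalizing i j with
  | zero => exact ⟨j, i, Or.inr ⟨rfl, rfl⟩, by simp [alt], by simp [alt]⟩
  | succ k ih =>
    obtain ⟨x, y, hxy, h1, h2⟩ := ih j i
    refine ⟨x, y, hxy.symm.imp id id, ?_, ?_⟩
    · rw [alt, h1, mul_assoc]; rfl
    · rw [alt, h2, mul_assoc]; rfl

theorem alt_add (i j : ι) (m n : ℕ) :
    ∃ u, R.length u ≤ n ∧ R.alt i j (m + n) = u * R.alt i j m := by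
  induction n with
  | zero => exact ⟨1, by rw [length_one], by simp⟩
  | succ n ih =>
    obtain ⟨u, hu, h⟩ := ih
    obtain ⟨x, -, -, h1, -⟩ := R.alt_succ_left i j (m + n)
    refine ⟨R.gen x * u, ?_, by rw [← add_assoc, h1, h, mul_assoc]⟩
    have := R.length_mul_le (R.gen x) u
    have := R.length_gen_le x
    omega

theorem length_alt_le (i j : ι) (k : ℕ) : R.length (R.alt i j k) ≤ k := by
  obtain ⟨u, hu, h⟩ := R.alt_add i j 0 k
  rw [zero_add, alt, mul_one] at h
  rwa [h]

/-- The reflection `s_j` in the coordinates of the plane spanned by `a_i` and `a_j`, affinely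
translated by `v`. -/
theorem act_gen_add {i j : ι} {A : ℝ} (hA : R.simpleCoroot j (R.simpleRoot i) = -A) (v : V)
    (p q : ℝ) :
    R.act (R.gen j) (v + p • R.simpleRoot i + q • R.simpleRoot j) =
      v + p • R.simpleRoot i + (A * p - q - R.simpleCoroot j v) • R.simpleRoot j := by
  rw [act_gen]
  simp only [map_add, map_smul, hA, R.pairing_self, smul_eq_mul]
  module

theorem act_gen_add' {i j : ι} {B : ℝ} (hB : R.simpleCoroot i (R.simpleRoot j) = -B) (v : V)
    (p q : ℝ) :
    R.act (R.gen i) (v + p • R.simpleRoot i + q • R.simpleRoot j) =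
      v + (B * q - p - R.simpleCoroot i v) • R.simpleRoot i + q • R.simpleRoot j := by
  rw [act_gen]
  simp only [map_add, map_smul, hB, R.pairing_self, smul_eq_mul]
  module

/-- In an infinite dihedral situation, alternating products preserve the positive quadrant, if
one starts in the half of it where the first reflection increases the coordinates. -/
theorem act_alt_of_four_le {A B : ℕ} (h4 : 4 ≤ A * B) {i j : ι}
    (hA : R.simpleCoroot j (R.simpleRoot i) = -A) (hB : R.simpleCoroot i (R.simpleRoot j) = -B)
    (k p q : ℕ) (hpq : 2 * q ≤ A * p) :
    ∃ p' q' : ℕ, R.act (R.alt i j k) (p • R.simpleRoot i + q • R.simpleRoot j) =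
      p' • R.simpleRoot i + q' • R.simpleRoot j := by
  induction k generalizing A B i j p q with
  | zero => exact ⟨p, q, rfl⟩
  | succ k ih =>
    have hq : q ≤ A * p := by omega
    obtain ⟨q', p', h⟩ := ih (by rwa [mul_comm]) hB hA (A * p - q) p (by
      zify [hq]
      zify at h4 hpq
      nlinarith [mul_le_mul_of_nonneg_right h4 (Int.natCast_nonneg p)])
    refine ⟨p', q', ?_⟩
    rw [add_comm (p' • _), ← h, act_alt_succ]
    congr 1
    have := R.act_gen_add hA 0 p q
    simp only [zero_add, map_zero, sub_zero] at this
    simp only [← Nat.cast_smul_eq_nsmul ℝ, Nat.cast_sub hq, Nat.cast_mul]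
    rw [this, add_comm]

/-- The order of `s_i s_j` in terms of the product `c` of the two Cartan integers, when it is
finite, that is, for `c < 4`. -/
def braidLength (c : ℕ) : ℕ :=
  if c = 0 then 2 else if c = 1 then 3 else if c = 2 then 4 else 6

/-- The braid relation. It is checked in the coordinates of the affine plane through `v` spanned by
`a_i` and `a_j`, for each of the possible pairs of Cartan integers. -/
theorem alt_braid {A B : ℕ} (h4 : A * B < 4) (h0 : A = 0 ↔ B = 0) {i j : ι}
    (hA : R.simpleCoroot j (R.simpleRoot i) = -A) (hB : R.simpleCoroot i (R.simpleRoot j) = -B) :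
    R.alt i j (braidLength (A * B)) = R.alt j i (braidLength (A * B)) := by
  have key : (A = 0 ∧ B = 0) ∨ (A = 1 ∧ B = 1) ∨ (A = 1 ∧ B = 2) ∨ (A = 2 ∧ B = 1) ∨
      (A = 1 ∧ B = 3) ∨ (A = 3 ∧ B = 1) := by
    rcases Nat.eq_zero_or_pos A with h | h
    · exact Or.inl ⟨h, h0.1 h⟩
    · have hB0 : 0 < B := Nat.pos_of_ne_zero fun h' => h.ne' (h0.2 h')
      have : A < 4 := by nlinarith
      have : B < 4 := by nlinarith
      interval_cases A <;> interval_cases B <;> simp_all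
  apply R.act_ext
  intro v
  have e1 := R.act_gen_add hA v
  have e2 := R.act_gen_add' hB v
  have hv : v = v + (0 : ℝ) • R.simpleRoot i + (0 : ℝ) • R.simpleRoot j := by simp
  rw [hv]
  rcases key with h | h | h | h | h | h <;> obtain ⟨rfl, rfl⟩ := h <;>
    simp only [braidLength, one_ne_zero, if_true, if_false, mul_zero, mul_one, one_mul,
      OfNat.ofNat_ne_zero, OfNat.ofNat_ne_one, Nat.reduceEqDiff, act_alt_succ, e1, e2] <;>
    simp only [alt, act_one, Nat.cast_zero, Nat.cast_one, Nat.cast_ofNat] <;>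
    module

/-- If `s_i s_j` has finite order, then alternating products shorter than the longest element of
the dihedral group, and ending in `s_j`, keep `a_i` positive. -/
theorem act_alt_of_lt {A B : ℕ} (h4 : A * B < 4) {i j : ι}
    (hA : R.simpleCoroot j (R.simpleRoot i) = -A) (hB : R.simpleCoroot i (R.simpleRoot j) = -B)
    {k : ℕ} (hk : k < braidLength (A * B)) :
    ∃ p q : ℕ, R.act (R.alt i j k) (R.simpleRoot i) = p • R.simpleRoot i + q • R.simpleRoot j := by
  have e1 := R.act_gen_add hA 0
  have e2 := R.act_gen_add' hB 0
  simp only [zero_add, map_zero, sub_zero] at e1 e2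
  have hv : R.simpleRoot i = (1 : ℝ) • R.simpleRoot i + (0 : ℝ) • R.simpleRoot j := by simp
  have hABr : ((A * B : ℕ) : ℝ) = A * B := by push_cast; ring
  have main : ∀ (p q : ℕ), (∃ P Q : ℝ, R.act (R.alt i j k)
      ((1 : ℝ) • R.simpleRoot i + (0 : ℝ) • R.simpleRoot j) = P • R.simpleRoot i +
      Q • R.simpleRoot j ∧ P = p ∧ Q = q) →
      ∃ p q : ℕ, R.act (R.alt i j k) (R.simpleRoot i) =
        p • R.simpleRoot i + q • R.simpleRoot j := by
    rintro p q ⟨P, Q, h, rfl, rfl⟩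
    exact ⟨p, q, by rw [hv, h, ← hv]; simp only [Nat.cast_smul_eq_nsmul]⟩
  have hk6 : k < 6 := hk.trans_le (by unfold braidLength; split_ifs <;> norm_num)
  generalize hc : A * B = c at *
  have hc' : (A : ℝ) * B = c := hABr.symm
  interval_cases k
  · exact ⟨1, 0, by simp [alt]⟩
  · refine main 1 A ⟨_, _, by rw [act_alt_succ, e1]; rfl, by simp, by simp⟩
  · have : 1 ≤ c := by
      by_contra h
      obtain rfl : c = 0 := by omega
      simp [braidLength] at hk
    refine main (c - 1) A ⟨_, _, by rw [act_alt_succ, e1, act_alt_succ, e2]; rfl, ?_, ?_⟩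
    · push_cast [this]
      linear_combination hc'
    · ring
  · have : 2 ≤ c := by
      by_contra h
      have : c < 2 := by omega
      interval_cases c <;> simp [braidLength] at hk
    refine main (c - 1) (A * (c - 2)) ⟨_, _, by
      rw [act_alt_succ, e1, act_alt_succ, e2, act_alt_succ, e1]; rfl, ?_, ?_⟩
    · push_cast [(by omega : 1 ≤ c)]
      linear_combination hc'
    · push_cast [this]
      linear_combination A * hc'
  · have : c = 3 := by
      interval_cases c <;> simp [braidLength] at hk ⊢
    subst this
    refine main 1 A ⟨_, _, by
      rw [act_alt_succ, e1, act_alt_succ, e2, act_alt_succ, e1, act_alt_succ, e2]; rfl, ?_, ?_⟩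
    · push_cast at hc' ⊢
      linear_combination (A * B) * hc'
    · push_cast at hc' ⊢
      linear_combination A * hc'
  · have : c = 3 := by
      interval_cases c <;> simp [braidLength] at hk ⊢
    subst this
    refine main 1 0 ⟨_, _, by
      rw [act_alt_succ, e1, act_alt_succ, e2, act_alt_succ, e1, act_alt_succ, e2,
        act_alt_succ, e1]; rfl, ?_, ?_⟩
    · push_cast at hc' ⊢
      linear_combination (A * B) * hc'
    · push_cast at hc' ⊢
      linear_combination (A * A * B - A) * hc'

end RankTwo

/-! ### Positive and negative roots -/

section Positivity

variable {ι V : Type*} [AddCommGroup V] [Module ℝ V] (R : KacMoodyRootSystem ι V)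

/-- The monoid of combinations of simple roots with coefficients in `ℕ`. -/
def posCone : AddSubmonoid V := AddSubmonoid.closure (Set.range R.simpleRoot)

theorem simpleRoot_mem_posCone (i : ι) : R.simpleRoot i ∈ R.posCone :=
  AddSubmonoid.subset_closure (Set.mem_range_self i)

theorem exists_pairing_eq_neg_nat {i j : ι} (hij : i ≠ j) :
    ∃ A : ℕ, R.simpleCoroot j (R.simpleRoot i) = -A := by
  obtain ⟨n, hn, h⟩ := R.pairing_nonpos i j hij
  refine ⟨n.natAbs, ?_⟩
  rw [h, Nat.cast_natAbs, abs_of_nonpos hn]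
  simp

/-- If `w` cannot be shortened by `s_i` on the right, then `w a_i` is a nonnegative combination of
simple roots. One factors `w = v u` with `u` alternating in `s_i` and some `s_j`, as long as
possible with lengths adding up; then induction applies to `v a_i` and `v a_j`, and `u a_i` is a
nonnegative combination of `a_i` and `a_j` by the computation in rank two. -/
theorem act_simpleRoot_mem_posCone (w : R.weylGroup) (i : ι)
    (h : R.length w ≤ R.length (w * R.gen i)) : R.act w (R.simpleRoot i) ∈ R.posCone := by
  induction hn : R.length w using Nat.strong_induction_on generalizing w i with
  | _ n ih =>
  by_cases hw : w = 1
  · subst hw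
    exact R.simpleRoot_mem_posCone i
  obtain ⟨j, hj⟩ := R.exists_length_mul_gen_lt hw
  have hij : i ≠ j := by
    rintro rfl
    omega
  -- the longest alternating right factor with lengths adding up
  let P : ℕ → Prop := fun k => ∃ v, w = v * R.alt i j k ∧ R.length w = R.length v + k
  classical
  have hP1 : P 1 := by
    refine ⟨w * R.gen j, ?_, ?_⟩
    · simp only [alt, one_mul, mul_gen_mul_gen]
    · have := R.length_le_length_mul_gen w j
      omega
  have hPle : ∀ k, P k → k ≤ n := by
    rintro k ⟨v, -, hv⟩
    omega
  obtain ⟨k, hk1, hPk, hmax⟩ : ∃ k, 1 ≤ k ∧ P k ∧ ¬ P (k + 1) := by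
    refine ⟨Nat.findGreatest P n, Nat.le_findGreatest (hPle 1 hP1) hP1,
      Nat.findGreatest_spec (hPle 1 hP1) hP1, fun hP => ?_⟩
    exact absurd (Nat.le_findGreatest (hPle _ hP) hP) (by omega)
  obtain ⟨v, hwv, hlen⟩ := hPk
  obtain ⟨k, rfl⟩ : ∃ k', k = k' + 1 := ⟨k - 1, by omega⟩
  obtain ⟨x, y, hxy, hx, hy⟩ := R.alt_succ_left i j k
  have hlx : R.length v ≤ R.length (v * R.gen x) := by
    have h1 : w = v * R.gen x * R.alt i j k := by rw [hwv, hx, mul_assoc]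
    have h2 := R.length_mul_le (v * R.gen x) (R.alt i j k)
    have h3 := R.length_alt_le i j k
    rw [← h1] at h2
    omega
  have hly : R.length v ≤ R.length (v * R.gen y) := by
    by_contra hlt
    refine hmax ⟨v * R.gen y, ?_, ?_⟩
    · rw [hy, ← mul_assoc, mul_gen_mul_gen, hwv]
    · have := R.length_le_length_mul_gen v y
      omega
  have hvn : R.length v < n := by omega
  have hvi : R.act v (R.simpleRoot i) ∈ R.posCone := by
    rcases hxy with ⟨rfl, rfl⟩ | ⟨rfl, rfl⟩
    · exact ih _ hvn v x hlx rfl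
    · exact ih _ hvn v y hly rfl
  have hvj : R.act v (R.simpleRoot j) ∈ R.posCone := by
    rcases hxy with ⟨rfl, rfl⟩ | ⟨rfl, rfl⟩
    · exact ih _ hvn v y hly rfl
    · exact ih _ hvn v x hlx rfl
  obtain ⟨A, hA⟩ := R.exists_pairing_eq_neg_nat hij
  obtain ⟨B, hB⟩ := R.exists_pairing_eq_neg_nat hij.symm
  suffices hsuff : ∃ p q : ℕ, R.act (R.alt i j (k + 1)) (R.simpleRoot i) =
      p • R.simpleRoot i + q • R.simpleRoot j by
    obtain ⟨p, q, hpq⟩ := hsuff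
    rw [hwv, act_mul, hpq, map_add, map_nsmul, map_nsmul]
    exact add_mem (nsmul_mem hvi p) (nsmul_mem hvj q)
  by_cases h4 : 4 ≤ A * B
  · simpa using R.act_alt_of_four_le h4 hA hB (k + 1) 1 0 (by omega)
  push Not at h4
  have h0 : A = 0 ↔ B = 0 := by
    constructor
    · rintro rfl
      have := R.pairing_eq_zero i j (by simpa using hA)
      rw [hB] at this
      simpa using this
    · rintro rfl
      have := R.pairing_eq_zero j i (by simpa using hB)
      rw [hA] at this
      simpa using this
  refine R.act_alt_of_lt h4 hA hB ?_
  -- otherwise the braid relation would show that `s_i` shortens `w`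
  by_contra hge
  push Not at hge
  obtain ⟨d, hd⟩ := Nat.exists_eq_add_of_le hge
  obtain ⟨u, hu, hu'⟩ := R.alt_add i j (braidLength (A * B)) d
  obtain ⟨m, hm⟩ : ∃ m, braidLength (A * B) = m + 1 := by
    refine ⟨braidLength (A * B) - 1, ?_⟩
    have : 0 < braidLength (A * B) := by
      unfold braidLength
      split_ifs <;> norm_num
    omega
  have hwi : w * R.gen i = v * (u * R.alt i j m) := by
    rw [hwv, hd, hu', R.alt_braid h4 h0 hA hB, hm, alt]
    simp only [mul_assoc, gen_mul_gen, mul_one]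
  have h1 := R.length_mul_le v (u * R.alt i j m)
  have h2 := R.length_mul_le u (R.alt i j m)
  have h3 := R.length_alt_le i j m
  rw [← hwi] at h1
  omega

theorem neg_act_simpleRoot_mem_posCone (w : R.weylGroup) (i : ι)
    (h : R.length (w * R.gen i) ≤ R.length w) : -R.act w (R.simpleRoot i) ∈ R.posCone := by
  have := R.act_simpleRoot_mem_posCone (w * R.gen i) i (by rwa [mul_gen_mul_gen])
  rwa [act_mul, act_gen_self, map_neg] at this

theorem act_simpleRoot_mem_or (w : R.weylGroup) (i : ι) :
    R.act w (R.simpleRoot i) ∈ R.posCone ∨ -R.act w (R.simpleRoot i) ∈ R.posCone :=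
  (le_total _ _).imp (R.act_simpleRoot_mem_posCone w i) (R.neg_act_simpleRoot_mem_posCone w i)

/-- The basis of simple roots of their span. -/
def rootBasis : Module.Basis ι ℝ (Submodule.span ℝ (Set.range R.simpleRoot)) :=
  Module.Basis.span R.linearIndependent_simpleRoot

theorem exists_coord (i : ι) : ∃ f : Module.Dual ℝ V, f (R.simpleRoot i) = 1 ∧
    ∀ j, j ≠ i → f (R.simpleRoot j) = 0 := by
  obtain ⟨f, hf⟩ := LinearMap.exists_extend (R.rootBasis.coord i)
  have h : ∀ j, f (R.simpleRoot j) = R.rootBasis.coord i (R.rootBasis j) := by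
    intro j
    rw [← hf, LinearMap.comp_apply]
    congr 1
    exact congrArg Subtype.val (Module.Basis.span_apply R.linearIndependent_simpleRoot j).symm
  refine ⟨f, by rw [h]; simp, fun j hj => ?_⟩
  rw [h, Module.Basis.coord_apply, Module.Basis.repr_self, Finsupp.single_eq_of_ne hj.symm]

/-- The coefficient of the simple root `a_i`, as a linear form on `V`; outside the span of the
simple roots its values depend on a choice. -/
def coeff (i : ι) : Module.Dual ℝ V := (R.exists_coord i).choose

theorem coeff_self (i : ι) : R.coeff i (R.simpleRoot i) = 1 := (R.exists_coord i).choose_spec.1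

theorem coeff_of_ne {i j : ι} (h : j ≠ i) : R.coeff i (R.simpleRoot j) = 0 :=
  (R.exists_coord i).choose_spec.2 j h

theorem exists_coeff_eq_nat {b : V} (hb : b ∈ R.posCone) (i : ι) : ∃ n : ℕ, R.coeff i b = n := by
  induction hb using AddSubmonoid.closure_induction with
  | mem x hx =>
    obtain ⟨j, rfl⟩ := hx
    by_cases h : j = i
    · subst h
      exact ⟨1, by simp [coeff_self]⟩
    · exact ⟨0, by simp [coeff_of_ne R h]⟩
  | zero => exact ⟨0, by simp⟩
  | add x y _ _ hx hy =>
    obtain ⟨m, hm⟩ := hx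
    obtain ⟨n, hn⟩ := hy
    exact ⟨m + n, by simp [hm, hn]⟩

theorem coeff_nonneg {b : V} (hb : b ∈ R.posCone) (i : ι) : 0 ≤ R.coeff i b := by
  obtain ⟨n, hn⟩ := R.exists_coeff_eq_nat hb i
  rw [hn]
  exact n.cast_nonneg

theorem eq_sum_coeff [Fintype ι] {b : V} (hb : b ∈ R.posCone) :
    b = ∑ i, R.coeff i b • R.simpleRoot i := by
  classical
  induction hb using AddSubmonoid.closure_induction with
  | mem x hx =>
    obtain ⟨j, rfl⟩ := hx
    rw [Finset.sum_eq_single j]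
    · rw [coeff_self, one_smul]
    · intro i _ hi
      rw [R.coeff_of_ne hi.symm, zero_smul]
    · intro h
      exact absurd (Finset.mem_univ j) h
  | zero => simp
  | add x y _ _ hx hy =>
    simp only [map_add, add_smul, Finset.sum_add_distrib]
    rw [← hx, ← hy]

theorem eq_zero_of_mem_neg_mem [Fintype ι] {b : V} (hb : b ∈ R.posCone) (hb' : -b ∈ R.posCone) :
    b = 0 := by
  rw [R.eq_sum_coeff hb]
  refine Finset.sum_eq_zero fun i _ => ?_
  have h1 := R.coeff_nonneg hb i
  have h2 := R.coeff_nonneg hb' i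
  rw [map_neg] at h2
  rw [le_antisymm (by linarith) h1, zero_smul]

theorem act_simpleRoot_ne_zero (w : R.weylGroup) (i : ι) : R.act w (R.simpleRoot i) ≠ 0 := by
  simpa using R.simpleRoot_ne_zero i

theorem act_simpleRoot_mem_posCone_iff [Fintype ι] (w : R.weylGroup) (i : ι) :
    R.act w (R.simpleRoot i) ∈ R.posCone ↔ R.length (w * R.gen i) = R.length w + 1 := by
  constructor
  · intro h
    have h1 : R.length w < R.length (w * R.gen i) := by
      by_contra hle
      exact R.act_simpleRoot_ne_zero w i (R.eq_zero_of_mem_neg_mem h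
        (R.neg_act_simpleRoot_mem_posCone w i (not_lt.1 hle)))
    have := R.length_mul_gen_le w i
    omega
  · intro h
    exact R.act_simpleRoot_mem_posCone w i (by omega)

/-- Only `1` keeps all simple roots positive. -/
theorem eq_one_of_act_mem [Fintype ι] {w : R.weylGroup}
    (h : ∀ i, R.act w (R.simpleRoot i) ∈ R.posCone) : w = 1 := by
  by_contra hw
  obtain ⟨i, hi⟩ := R.exists_length_mul_gen_lt hw
  have := (R.act_simpleRoot_mem_posCone_iff w i).1 (h i)
  omega

/-- If `w a_i = a_j`, then `w` conjugates `s_i` to `s_j`: the element `w⁻¹ s_j w s_i` changes simple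
roots by multiples of `a_i` and fixes `a_i`, hence it keeps all simple roots positive. -/
theorem gen_mul_eq_mul_gen [Fintype ι] {w : R.weylGroup} {i j : ι}
    (h : R.act w (R.simpleRoot i) = R.simpleRoot j) : R.gen j * w = w * R.gen i := by
  have hinv : R.act w⁻¹ (R.simpleRoot j) = R.simpleRoot i := by rw [← h, act_inv_act]
  set u := w⁻¹ * R.gen j * w * R.gen i with hu
  have hformula : ∀ v, ∃ c : ℝ, R.act u v = v + c • R.simpleRoot i := by
    intro v
    refine ⟨-R.simpleCoroot i v -
      R.simpleCoroot j (R.act w (v - R.simpleCoroot i v • R.simpleRoot i)), ?_⟩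
    rw [hu, act_mul, act_mul, act_mul, R.act_gen i, R.act_gen j, map_sub, act_inv_act,
      map_smul (R.act w⁻¹), hinv]
    module
  have hui : R.act u (R.simpleRoot i) = R.simpleRoot i := by
    rw [hu, act_mul, act_gen_self, act_mul, act_mul, map_neg, h, map_neg, act_gen_self, neg_neg,
      hinv]
  have h1 : u = 1 := by
    refine R.eq_one_of_act_mem fun k => ?_
    by_cases hk : k = i
    · subst hk
      rw [hui]
      exact R.simpleRoot_mem_posCone k
    · rcases R.act_simpleRoot_mem_or u k with hpos | hneg
      · exact hpos
      · exfalso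
        obtain ⟨c, hc⟩ := hformula (R.simpleRoot k)
        have := R.coeff_nonneg hneg k
        rw [hc, map_neg, map_add, map_smul, coeff_self, R.coeff_of_ne (Ne.symm hk)] at this
        norm_num at this
  have h2 : w * u * R.gen i = R.gen j * w := by
    rw [hu]
    simp only [mul_assoc, gen_mul_gen, mul_one, mul_inv_cancel_left]
  rw [← h2, h1, mul_one]

end Positivity

/-! ### The dual root system and coroots -/

section Dual

variable {ι V : Type*} [AddCommGroup V] [Module ℝ V] (R : KacMoodyRootSystem ι V)

/-- The dual root system, in which roots and coroots are exchanged. -/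
def dual : KacMoodyRootSystem ι (Module.Dual ℝ V) where
  simpleRoot := R.simpleCoroot
  simpleCoroot i := Module.Dual.eval ℝ V (R.simpleRoot i)
  linearIndependent_simpleRoot := R.linearIndependent_simpleCoroot
  linearIndependent_simpleCoroot :=
    R.linearIndependent_simpleRoot.map' _ (LinearMap.ker_eq_bot.2 (Module.eval_apply_injective ℝ))
  pairing_self := R.pairing_self
  pairing_nonpos i j h := R.pairing_nonpos j i h.symm
  pairing_eq_zero i j := R.pairing_eq_zero j i

theorem dualAct_apply (w : R.weylGroup) (l : Module.Dual ℝ V) (v : V) :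
    R.dualAct w l v = l (R.act w⁻¹ v) := rfl

theorem dualAct_apply_act (w : R.weylGroup) (l : Module.Dual ℝ V) (v : V) :
    R.dualAct w l (R.act w v) = l v := by
  rw [dualAct_apply, act_inv_act]

@[simp] theorem dualAct_one (l : Module.Dual ℝ V) : R.dualAct 1 l = l := by
  ext v
  rw [dualAct_apply, inv_one, act_one]

theorem dualAct_mul (w w' : R.weylGroup) (l : Module.Dual ℝ V) :
    R.dualAct (w * w') l = R.dualAct w (R.dualAct w' l) := by
  ext v
  rw [dualAct_apply, mul_inv_rev, act_mul]
  rfl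

theorem dualAct_neg (w : R.weylGroup) (l : Module.Dual ℝ V) :
    R.dualAct w (-l) = -R.dualAct w l := rfl

theorem dualAct_injective {w w' : R.weylGroup} (h : ∀ l, R.dualAct w l = R.dualAct w' l) :
    w = w' := by
  rw [← inv_inj]
  refine R.act_ext fun v => Module.eval_apply_injective ℝ ?_
  ext l
  exact LinearMap.congr_fun (h l) v

theorem dual_act_gen (i : ι) (l : Module.Dual ℝ V) :
    R.dual.act (R.dual.gen i) l = R.dualAct (R.gen i) l := by
  ext v
  rw [act_gen, dualAct_apply, gen_inv, act_gen, map_sub, map_smul]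
  simp only [dual, Module.Dual.eval_apply, LinearMap.sub_apply, LinearMap.smul_apply, smul_eq_mul,
    mul_comm]

theorem dual_act_prod (L : List ι) (l : Module.Dual ℝ V) :
    R.dual.act (L.map R.dual.gen).prod l = R.dualAct (L.map R.gen).prod l := by
  induction L with
  | nil => simp
  | cons i L ih =>
    rw [List.map_cons, List.prod_cons, List.map_cons, List.prod_cons, act_mul, ih, dual_act_gen,
      dualAct_mul]

/-- The Weyl group element of the dual system acting on the dual space like `w`. -/
def toDual (w : R.weylGroup) : R.dual.weylGroup :=
  ((R.exists_prod_gen w).choose.map R.dual.gen).prod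

theorem act_toDual (w : R.weylGroup) (l : Module.Dual ℝ V) :
    R.dual.act (R.toDual w) l = R.dualAct w l := by
  rw [toDual, dual_act_prod, (R.exists_prod_gen w).choose_spec]

theorem toDual_mul (w w' : R.weylGroup) : R.toDual (w * w') = R.toDual w * R.toDual w' := by
  refine R.dual.act_ext fun l => ?_
  rw [act_mul, act_toDual, act_toDual, act_toDual, dualAct_mul]

theorem toDual_gen (i : ι) : R.toDual (R.gen i) = R.dual.gen i := by
  refine R.dual.act_ext fun l => ?_
  rw [act_toDual, dual_act_gen]

theorem toDual_prod (L : List ι) :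
    R.toDual (L.map R.gen).prod = (L.map R.dual.gen).prod := by
  refine R.dual.act_ext fun l => ?_
  rw [act_toDual, dual_act_prod]

theorem toDual_injective : Function.Injective R.toDual := by
  intro w w' h
  refine R.dualAct_injective fun l => ?_
  rw [← act_toDual, h, act_toDual]

theorem length_toDual (w : R.weylGroup) : R.dual.length (R.toDual w) = R.length w := by
  apply le_antisymm
  · obtain ⟨L, h1, h2⟩ := R.exists_reduced_word w
    rw [← h1, ← h2, toDual_prod]
    exact R.dual.length_prod_gen_le L
  · obtain ⟨L, h1, h2⟩ := R.dual.exists_reduced_word (R.toDual w)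
    rw [← toDual_prod] at h2
    rw [← h1, ← R.toDual_injective h2]
    exact R.length_prod_gen_le L

/-- The relation `s_j w = w s_i` as an identity between rank one maps. -/
theorem gen_mul_eq_mul_gen_iff {w : R.weylGroup} {i j : ι} :
    (R.gen j * w = w * R.gen i) ↔
      ∀ x, R.simpleCoroot j (R.act w x) • R.simpleRoot j =
        R.simpleCoroot i x • R.act w (R.simpleRoot i) := by
  constructor
  · intro h x
    have := congrArg (fun u => R.act u x) h
    simpa only [act_mul, act_gen, map_sub, map_smul, sub_right_inj] using this
  · intro h
    refine R.act_ext fun x => ?_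
    rw [act_mul, act_mul, act_gen, act_gen, map_sub, map_smul, h]

theorem mem_realRoots_iff {b : V} :
    b ∈ R.realRoots ↔ ∃ w i, b = R.act w (R.simpleRoot i) := Iff.rfl

theorem act_mem_realRoots {b : V} (hb : b ∈ R.realRoots) (w : R.weylGroup) :
    R.act w b ∈ R.realRoots := by
  obtain ⟨w', i, rfl⟩ := hb
  exact ⟨w * w', i, rfl⟩

theorem neg_mem_realRoots {b : V} (hb : b ∈ R.realRoots) : -b ∈ R.realRoots := by
  obtain ⟨w, i, rfl⟩ := R.mem_realRoots_iff.1 hb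
  exact ⟨w * R.gen i, i, by
    rw [← map_neg, ← act_gen_self, ← act_mul]; rfl⟩

theorem dualAct_gen_self (i : ι) : R.dualAct (R.gen i) (R.simpleCoroot i) = -R.simpleCoroot i := by
  rw [← dual_act_gen]
  exact R.dual.act_gen_self i

variable [Fintype ι]

/-- A root `w a_i` and its coroot `w a_i^∨` are positive simultaneously, since both conditions say
that `s_i` does not shorten `w`. -/
theorem dualAct_simpleCoroot_mem_posCone_iff (w : R.weylGroup) (i : ι) :
    R.dualAct w (R.simpleCoroot i) ∈ R.dual.posCone ↔ R.act w (R.simpleRoot i) ∈ R.posCone := by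
  rw [act_simpleRoot_mem_posCone_iff, ← R.length_toDual (w * R.gen i), ← R.length_toDual w,
    toDual_mul, toDual_gen, ← act_simpleRoot_mem_posCone_iff, act_toDual]
  rfl

theorem dualAct_simpleCoroot_eq {w : R.weylGroup} {i j : ι}
    (h : R.act w (R.simpleRoot i) = R.simpleRoot j) :
    R.dualAct w (R.simpleCoroot i) = R.simpleCoroot j := by
  ext v
  have h1 := R.gen_mul_eq_mul_gen_iff.1 (R.gen_mul_eq_mul_gen h) (R.act w⁻¹ v)
  rw [act_act_inv, h] at h1
  exact (smul_left_injective ℝ (R.simpleRoot_ne_zero j) h1).symm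

theorem act_simpleRoot_eq {w : R.weylGroup} {i j : ι}
    (h : R.dualAct w (R.simpleCoroot i) = R.simpleCoroot j) :
    R.act w (R.simpleRoot i) = R.simpleRoot j := by
  have h1 : R.dual.gen j * R.toDual w = R.toDual w * R.dual.gen i :=
    R.dual.gen_mul_eq_mul_gen (by rw [act_toDual]; exact h)
  rw [← toDual_gen, ← toDual_gen, ← toDual_mul, ← toDual_mul] at h1
  have h2 := R.gen_mul_eq_mul_gen_iff.1 (R.toDual_injective h1) (R.simpleRoot i)
  rw [← h, dualAct_apply_act, R.pairing_self] at h2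
  exact (smul_right_injective V (two_ne_zero (α := ℝ)) h2).symm

/-- The coroot of `w a_i` is `w a_i^∨`, whichever representation of the root is chosen. -/
theorem coroot_act_simpleRoot (w : R.weylGroup) (i : ι) :
    R.coroot (R.act w (R.simpleRoot i)) = R.dualAct w (R.simpleCoroot i) := by
  have hb : R.act w (R.simpleRoot i) ∈ R.realRoots := ⟨w, i, rfl⟩
  rw [coroot, dif_pos hb]
  have h : R.act w (R.simpleRoot i) = R.act hb.choose (R.simpleRoot hb.choose_spec.choose) :=
    hb.choose_spec.choose_spec
  have h1 := R.dualAct_simpleCoroot_eq (w := hb.choose⁻¹ * w) (i := i)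
    (j := hb.choose_spec.choose) (by
      rw [act_mul]
      exact (congrArg _ h).trans (R.act_inv_act _ _))
  rw [← h1, ← dualAct_mul, mul_inv_cancel_left]

theorem coroot_act {b : V} (hb : b ∈ R.realRoots) (w : R.weylGroup) :
    R.coroot (R.act w b) = R.dualAct w (R.coroot b) := by
  obtain ⟨w', i, rfl⟩ := R.mem_realRoots_iff.1 hb
  rw [← act_mul, coroot_act_simpleRoot, coroot_act_simpleRoot, dualAct_mul]

theorem coroot_neg {b : V} (hb : b ∈ R.realRoots) : R.coroot (-b) = -R.coroot b := by
  obtain ⟨w, i, rfl⟩ := R.mem_realRoots_iff.1 hb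
  rw [coroot_act_simpleRoot, ← map_neg, ← act_gen_self, ← act_mul, coroot_act_simpleRoot,
    dualAct_mul, dualAct_gen_self, dualAct_neg]

theorem coroot_mem_posCone {b : V} (hb : b ∈ R.posRealRoots) : R.coroot b ∈ R.dual.posCone := by
  obtain ⟨h, hpos⟩ := hb
  obtain ⟨w, i, rfl⟩ := R.mem_realRoots_iff.1 h
  rw [coroot_act_simpleRoot, dualAct_simpleCoroot_mem_posCone_iff]
  exact hpos

theorem coroot_ne_zero {b : V} (hb : b ∈ R.realRoots) : R.coroot b ≠ 0 := by
  obtain ⟨w, i, rfl⟩ := R.mem_realRoots_iff.1 hb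
  rw [coroot_act_simpleRoot, ← act_toDual]
  exact R.dual.act_simpleRoot_ne_zero _ i

/-- A real root is determined by its coroot. -/
theorem coroot_injOn : Set.InjOn R.coroot R.realRoots := by
  intro b hb b' hb' h
  obtain ⟨w, i, rfl⟩ := R.mem_realRoots_iff.1 hb
  obtain ⟨w', j, rfl⟩ := R.mem_realRoots_iff.1 hb'
  rw [coroot_act_simpleRoot, coroot_act_simpleRoot] at h
  have := R.act_simpleRoot_eq (w := w'⁻¹ * w) (i := i) (j := j) (by
    rw [dualAct_mul, h, ← dualAct_mul, inv_mul_cancel, dualAct_one])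
  rw [← this, act_mul, act_act_inv]

end Dual

/-! ### Inversions -/

section Inversions

variable {ι V : Type*} [AddCommGroup V] [Module ℝ V] (R : KacMoodyRootSystem ι V)

theorem mem_inversions_iff {w : R.weylGroup} {b : V} :
    b ∈ R.inversions w ↔ b ∈ R.posRealRoots ∧ -R.act w⁻¹ b ∈ R.posRealRoots := Iff.rfl

theorem simpleRoot_mem_posRealRoots (i : ι) : R.simpleRoot i ∈ R.posRealRoots :=
  ⟨⟨1, i, rfl⟩, R.simpleRoot_mem_posCone i⟩

theorem exists_coeff_act_simpleRoot_eq_int (w : R.weylGroup) (i k : ι) :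
    ∃ n : ℤ, R.coeff k (R.act w (R.simpleRoot i)) = n := by
  rcases R.act_simpleRoot_mem_or w i with h | h
  · obtain ⟨n, hn⟩ := R.exists_coeff_eq_nat h k
    exact ⟨n, by simpa using hn⟩
  · obtain ⟨n, hn⟩ := R.exists_coeff_eq_nat h k
    refine ⟨-n, ?_⟩
    rw [map_neg] at hn
    push_cast
    linarith

theorem mem_or_neg_mem_posRealRoots {b : V} (hb : b ∈ R.realRoots) :
    b ∈ R.posRealRoots ∨ -b ∈ R.posRealRoots := by
  have hn := R.neg_mem_realRoots hb
  obtain ⟨w, i, h⟩ := R.mem_realRoots_iff.1 hb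
  rcases R.act_simpleRoot_mem_or w i with hp | hp
  · exact Or.inl ⟨hb, by rw [h]; exact hp⟩
  · exact Or.inr ⟨hn, by rw [h]; exact hp⟩

theorem ne_zero_of_mem_realRoots {b : V} (hb : b ∈ R.realRoots) : b ≠ 0 := by
  obtain ⟨w, i, rfl⟩ := R.mem_realRoots_iff.1 hb
  exact R.act_simpleRoot_ne_zero w i

/-- The only multiple of a simple root which is a positive real root is the simple root itself,
because the coefficients of all real roots are integers. -/
theorem eq_simpleRoot_of_eq_smul {b : V} (hb : b ∈ R.posRealRoots) {i : ι} {c : ℝ}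
    (h : b = c • R.simpleRoot i) : b = R.simpleRoot i := by
  obtain ⟨w, k, hw⟩ := R.mem_realRoots_iff.1 hb.1
  obtain ⟨n, hn⟩ := R.exists_coeff_eq_nat hb.2 i
  have hcn : c = n := by
    rw [← hn, h, map_smul, coeff_self, smul_eq_mul, mul_one]
  have h1 : R.simpleRoot k = c • R.act w⁻¹ (R.simpleRoot i) := by
    rw [← map_smul, ← h, hw, act_inv_act]
  obtain ⟨m, hm⟩ := R.exists_coeff_act_simpleRoot_eq_int w⁻¹ i k
  have h2 : (1 : ℝ) = n * m := by
    rw [← hm, ← hcn, ← smul_eq_mul, ← map_smul, ← h1, coeff_self]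
  have h3 : (n : ℤ) * m = 1 := by exact_mod_cast h2.symm
  have h4 : (n : ℤ) = 1 := by
    rcases Int.eq_one_or_neg_one_of_mul_eq_one h3 with h | h
    · exact h
    · omega
  have h5 : n = 1 := by exact_mod_cast h4
  rw [h, hcn, h5, Nat.cast_one, one_smul]

variable [Fintype ι]

theorem neg_notMem_posRealRoots {b : V} (hb : b ∈ R.posRealRoots) : -b ∉ R.posRealRoots :=
  fun h => R.ne_zero_of_mem_realRoots hb.1 (R.eq_zero_of_mem_neg_mem hb.2 h.2)

/-- The reflection `s_i` permutes the positive real roots other than `a_i`. -/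
theorem act_gen_mem_posRealRoots {b : V} (hb : b ∈ R.posRealRoots) {i : ι}
    (hi : b ≠ R.simpleRoot i) : R.act (R.gen i) b ∈ R.posRealRoots := by
  rcases R.mem_or_neg_mem_posRealRoots (R.act_mem_realRoots hb.1 (R.gen i)) with h | h
  · exact h
  -- `s_i` changes only the coefficient of `a_i`, so the other coefficients of `b` must vanish
  · refine absurd (R.eq_simpleRoot_of_eq_smul hb (c := R.coeff i b) ?_) hi
    conv_lhs => rw [R.eq_sum_coeff hb.2]
    classical
    refine Finset.sum_eq_single i (fun k _ hk => ?_) (fun h => absurd (Finset.mem_univ i) h)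
    have h1 := R.coeff_nonneg h.2 k
    have h2 := R.coeff_nonneg hb.2 k
    rw [act_gen, map_neg, map_sub, map_smul, R.coeff_of_ne hk.symm, smul_zero, sub_zero] at h1
    rw [le_antisymm (by linarith) h2, zero_smul]

theorem inversions_one : R.inversions 1 = ∅ := by
  ext b
  simp only [mem_inversions_iff, inv_one, act_one, Set.mem_empty_iff_false, iff_false, not_and]
  exact R.neg_notMem_posRealRoots

theorem inversions_mul_gen {w : R.weylGroup} {i : ι}
    (h : R.length (w * R.gen i) = R.length w + 1) :
    R.inversions (w * R.gen i) = insert (R.act w (R.simpleRoot i)) (R.inversions w) := by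
  have hpos : R.act w (R.simpleRoot i) ∈ R.posRealRoots :=
    ⟨⟨w, i, rfl⟩, (R.act_simpleRoot_mem_posCone_iff w i).2 h⟩
  have hact : ∀ b, R.act (w * R.gen i)⁻¹ b = R.act (R.gen i) (R.act w⁻¹ b) := by
    intro b
    rw [mul_inv_rev, gen_inv, act_mul]
  ext b
  rw [Set.mem_insert_iff, mem_inversions_iff, mem_inversions_iff, hact]
  constructor
  · rintro ⟨hb, hneg⟩
    rcases R.mem_or_neg_mem_posRealRoots (R.act_mem_realRoots hb.1 w⁻¹) with hc | hc
    · left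
      by_contra hne
      refine R.neg_notMem_posRealRoots (R.act_gen_mem_posRealRoots hc fun he => hne ?_) hneg
      rw [← he, act_act_inv]
    · exact Or.inr ⟨hb, hc⟩
  · rintro (rfl | ⟨hb, hc⟩)
    · refine ⟨hpos, ?_⟩
      rw [act_inv_act, act_gen_self, neg_neg]
      exact R.simpleRoot_mem_posRealRoots i
    · refine ⟨hb, ?_⟩
      rw [← map_neg]
      refine R.act_gen_mem_posRealRoots hc fun he => ?_
      refine R.neg_notMem_posRealRoots hpos ?_
      rw [← he, map_neg, act_act_inv, neg_neg]
      exact hb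

theorem act_simpleRoot_notMem_inversions (w : R.weylGroup) (i : ι) :
    R.act w (R.simpleRoot i) ∉ R.inversions w := by
  rintro ⟨-, h⟩
  have h' : -R.act w⁻¹ (R.act w (R.simpleRoot i)) ∈ R.posRealRoots := h
  rw [act_inv_act] at h'
  exact R.neg_notMem_posRealRoots (R.simpleRoot_mem_posRealRoots i) h'

/-- The number of inversions of `w` is its length. -/
theorem finite_inversions_and_ncard (w : R.weylGroup) :
    (R.inversions w).Finite ∧ (R.inversions w).ncard = R.length w := by
  induction hn : R.length w generalizing w with
  | zero =>
    have : w = 1 := by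
      by_contra hw
      obtain ⟨i, hi⟩ := R.exists_length_mul_gen_lt hw
      omega
    subst this
    simp [inversions_one]
  | succ n ih =>
    have hw : w ≠ 1 := by
      rintro rfl
      rw [length_one] at hn
      omega
    obtain ⟨i, hi⟩ := R.exists_length_mul_gen_lt hw
    have h1 := R.length_le_length_mul_gen w i
    obtain ⟨hfin, hcard⟩ := ih (w * R.gen i) (by omega)
    have h2 := R.inversions_mul_gen (w := w * R.gen i) (i := i) (by rw [mul_gen_mul_gen]; omega)
    rw [mul_gen_mul_gen] at h2
    rw [h2]
    refine ⟨hfin.insert _, ?_⟩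
    rw [Set.ncard_insert_of_notMem (R.act_simpleRoot_notMem_inversions _ i) hfin, hcard]

theorem finite_inversions (w : R.weylGroup) : (R.inversions w).Finite :=
  (R.finite_inversions_and_ncard w).1

theorem ncard_inversions (w : R.weylGroup) : (R.inversions w).ncard = R.length w :=
  (R.finite_inversions_and_ncard w).2

end Inversions

end KacMoodyRootSystem

/-! ### Holomorphic limits in several variables -/

section Weierstrass

open Filter Topology Metric

/-- Cauchy's estimate for the Fréchet derivative, obtained by restriction to complex lines. -/
theorem norm_fderiv_le_of_forall_mem_ball {E : Type*} [NormedAddCommGroup E] [NormedSpace ℂ E]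
    {G : E → ℂ} {x : E} {r C : ℝ} (hG : DifferentiableOn ℂ G (ball x r))
    (hC : ∀ y ∈ ball x r, ‖G y‖ ≤ C) {y : E} (hy : y ∈ ball x (r / 2)) :
    ‖fderiv ℂ G y‖ ≤ 4 * C / r := by
  have hr : 0 < r := by
    have := pos_of_mem_ball hy
    linarith
  have hyr : y ∈ ball x r := ball_subset_ball (by linarith) hy
  have hC0 : 0 ≤ C := (norm_nonneg _).trans (hC y hyr)
  refine ContinuousLinearMap.opNorm_le_bound _ (by positivity) fun v => ?_
  rcases eq_or_ne v 0 with rfl | hv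
  · simp
  have hv0 : 0 < ‖v‖ := norm_pos_iff.2 hv
  -- the disk of radius `s` in the line `y + ℂ v` stays within the ball
  set s : ℝ := r / (4 * ‖v‖) with hs
  have hs0 : 0 < s := by positivity
  have hmem : ∀ z ∈ closedBall (0 : ℂ) s, y + z • v ∈ ball x r := by
    intro z hz
    rw [mem_closedBall_zero_iff] at hz
    rw [mem_ball, dist_eq_norm] at hy ⊢
    have h1 : ‖z • v‖ ≤ r / 4 := by
      rw [norm_smul]
      calc ‖z‖ * ‖v‖ ≤ s * ‖v‖ := by gcongr
        _ = r / 4 := by rw [hs]; field_simp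
    calc ‖y + z • v - x‖ = ‖(y - x) + z • v‖ := by congr 1; abel
      _ ≤ ‖y - x‖ + ‖z • v‖ := norm_add_le _ _
      _ < r := by linarith
  have hdiff : ∀ z ∈ closedBall (0 : ℂ) s,
      HasDerivAt (fun z : ℂ => G (y + z • v)) (fderiv ℂ G (y + z • v) v) z := by
    intro z hz
    have h1 : HasFDerivAt G (fderiv ℂ G (y + z • v)) (y + z • v) :=
      (hG.differentiableAt (isOpen_ball.mem_nhds (hmem z hz))).hasFDerivAt
    have h2 : HasDerivAt (fun z : ℂ => y + z • v) v z := by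
      simpa using ((hasDerivAt_id z).smul_const v).const_add y
    exact h1.comp_hasDerivAt z h2
  have hcont : DiffContOnCl ℂ (fun z : ℂ => G (y + z • v)) (ball 0 s) := by
    refine DifferentiableOn.diffContOnCl fun z hz => ?_
    rw [closure_ball _ hs0.ne'] at hz
    exact (hdiff z hz).differentiableAt.differentiableWithinAt
  have hderiv := (hdiff 0 (mem_closedBall_self hs0.le)).deriv
  rw [zero_smul, add_zero] at hderiv
  have h3 := Complex.norm_deriv_le_of_forall_mem_sphere_norm_le hs0 hcont
    (fun z hz => hC _ (hmem z (sphere_subset_closedBall hz)))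
  rw [hderiv] at h3
  refine h3.trans_eq ?_
  rw [hs]
  field_simp

/-- A locally uniform limit of holomorphic functions of several variables is holomorphic: by
Cauchy's estimate the derivatives converge locally uniformly as well. -/
theorem TendstoLocallyUniformlyOn.differentiableOn_of_properSpace {E ι : Type*}
    [NormedAddCommGroup E] [NormedSpace ℂ E] [ProperSpace E] {U : Set E} {φ : Filter ι} [φ.NeBot]
    {F : ι → E → ℂ} {f : E → ℂ} (hf : TendstoLocallyUniformlyOn F f φ U)
    (hF : ∀ n, DifferentiableOn ℂ (F n) U) (hU : IsOpen U) : DifferentiableOn ℂ f U := by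
  intro x hx
  obtain ⟨r, hr, hrU⟩ := nhds_basis_closedBall.mem_iff.1 (hU.mem_nhds hx)
  have hunif : TendstoUniformlyOn F f φ (ball x r) :=
    ((tendstoLocallyUniformlyOn_iff_forall_isCompact hU).1 hf _ hrU
      (isCompact_closedBall x r)).mono ball_subset_closedBall
  have hFr : ∀ n, DifferentiableOn ℂ (F n) (ball x r) := fun n =>
    (hF n).mono (ball_subset_closedBall.trans hrU)
  have hsub : ball x (r / 2) ⊆ ball x r := ball_subset_ball (by linarith)
  have hcauchy : UniformCauchySeqOn (fun n => fderiv ℂ (F n)) φ (ball x (r / 2)) := by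
    intro u hu
    obtain ⟨ε, hε, hεu⟩ := mem_uniformity_dist.1 hu
    have h1 := hunif.uniformCauchySeqOn _ (dist_mem_uniformity (show 0 < ε * r / 8 by positivity))
    filter_upwards [h1] with m hm y hy
    refine hεu ?_
    rw [dist_eq_norm]
    have hd : ∀ n, DifferentiableAt ℂ (F n) y := fun n =>
      (hFr n).differentiableAt (isOpen_ball.mem_nhds (hsub hy))
    rw [← fderiv_sub (hd m.1) (hd m.2)]
    refine (norm_fderiv_le_of_forall_mem_ball ((hFr m.1).sub (hFr m.2)) (C := ε * r / 8)
      (fun z hz => ?_) hy).trans_lt ?_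
    · have := hm z hz
      rw [dist_eq_norm] at this
      exact this.le
    · field_simp
      linarith
  have hlim : ∀ y ∈ ball x (r / 2), ∃ L, Tendsto (fun n => fderiv ℂ (F n) y) φ (𝓝 L) :=
    fun y hy => cauchy_map_iff_exists_tendsto.1 (hcauchy.cauchy_map hy)
  choose! g hg using hlim
  have hder := hasFDerivAt_of_tendstoUniformlyOn (x := x) isOpen_ball
    (hcauchy.tendstoUniformlyOn_of_tendsto hg)
    (fun n y hy => ((hFr n).differentiableAt (isOpen_ball.mem_nhds (hsub hy))).hasFDerivAt)
    (fun y hy => hunif.tendsto_at (hsub hy)) (mem_ball_self (by linarith))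
  exact hder.differentiableAt.differentiableWithinAt

/-- A local version of the Weierstrass M-test gives uniform convergence on compact sets. -/
theorem summableUniformlyOn_of_locally_bounded {α β F : Type*} [NormedAddCommGroup F]
    [CompleteSpace F] [TopologicalSpace β] {f : α → β → F} {K : Set β} (hK : IsCompact K)
    (h : ∀ x ∈ K, ∃ N ∈ 𝓝 x, ∃ u : α → ℝ, Summable u ∧ ∀ n, ∀ y ∈ N, ‖f n y‖ ≤ u n) :
    SummableUniformlyOn f K := by
  have h1 : HasSumLocallyUniformlyOn f (fun x => ∑' n, f n x) K := by
    refine hasSumLocallyUniformlyOn_of_of_forall_exists_nhds fun x hx => ?_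
    obtain ⟨N, hN, u, hu, hfu⟩ := h x hx
    exact ⟨N, mem_nhdsWithin_of_mem_nhds hN, HasSumUniformlyOn.of_norm_le_summable hu hfu⟩
  refine HasSumUniformlyOn.summableUniformlyOn (g := fun x => ∑' n, f n x) ?_
  rw [hasSumUniformlyOn_iff_tendstoUniformlyOn,
    ← tendstoLocallyUniformlyOn_iff_tendstoUniformlyOn_of_compact hK]
  exact h1

/-- A series of holomorphic functions with locally summable bounds has a holomorphic sum. -/
theorem differentiableOn_tsum_of_locally_bounded {E α : Type*} [NormedAddCommGroup E]
    [NormedSpace ℂ E] [ProperSpace E] {U : Set E} (hU : IsOpen U) {f : α → E → ℂ}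
    (hf : ∀ n, DifferentiableOn ℂ (f n) U)
    (h : ∀ x ∈ U, ∃ N ∈ 𝓝 x, ∃ u : α → ℝ, Summable u ∧ ∀ n, ∀ y ∈ N, ‖f n y‖ ≤ u n) :
    DifferentiableOn ℂ (fun x => ∑' n, f n x) U := by
  have h1 : HasSumLocallyUniformlyOn f (fun x => ∑' n, f n x) U := by
    refine hasSumLocallyUniformlyOn_of_of_forall_exists_nhds fun x hx => ?_
    obtain ⟨N, hN, u, hu, hfu⟩ := h x hx
    exact ⟨N, mem_nhdsWithin_of_mem_nhds hN, HasSumUniformlyOn.of_norm_le_summable hu hfu⟩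
  exact TendstoLocallyUniformlyOn.differentiableOn_of_properSpace h1
    (fun s => DifferentiableOn.fun_sum fun n _ => hf n) hU

/-- A product of holomorphic functions whose distances from `1` have locally summable bounds is
holomorphic. -/
theorem differentiableOn_tprod_of_locally_bounded {E α : Type*} [NormedAddCommGroup E]
    [NormedSpace ℂ E] [ProperSpace E] {U : Set E} (hU : IsOpen U) {f : α → E → ℂ}
    (hf : ∀ n, DifferentiableOn ℂ (f n) U)
    (h : ∀ x ∈ U, ∃ N ∈ 𝓝 x, ∃ u : α → ℝ, Summable u ∧ ∀ n, ∀ y ∈ N, ‖f n y - 1‖ ≤ u n) :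
    DifferentiableOn ℂ (fun x => ∏' n, f n x) U := by
  have h1 : HasProdLocallyUniformlyOn f (fun x => ∏' n, f n x) U := by
    refine hasProdLocallyUniformlyOn_of_of_forall_exists_nhds fun x hx => ?_
    obtain ⟨N, hN, u, hu, hfu⟩ := h x hx
    obtain ⟨K, ⟨hKx, hK⟩, hKN⟩ :=
      (compact_basis_nhds x).mem_iff.1 (Filter.inter_mem hN (hU.mem_nhds hx))
    refine ⟨K, mem_nhdsWithin_of_mem_nhds hKx, ?_⟩
    have := hu.hasProdUniformlyOn_one_add (f := fun n y => f n y - 1) hK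
      (Filter.Eventually.of_forall fun n y hy => hfu n y (hKN hy).1)
      (fun n => ((hf n).continuousOn.mono fun y hy => (hKN hy).2).sub continuousOn_const)
    simpa only [add_sub_cancel] using this
  refine TendstoLocallyUniformlyOn.differentiableOn_of_properSpace h1
    (fun s => ?_) hU
  classical
  induction s using Finset.induction_on with
  | empty => simp
  | insert n s hn ih => simpa only [Finset.prod_insert hn] using (hf n).fun_mul ih

end Weierstrass

/-! ### The complexification of a finite-dimensional space -/

namespace Complexification

section Algebra

variable {V : Type*} [AddCommGroup V] [Module ℝ V]

theorem pairing_neg (h : Complexification V) (l : Module.Dual ℝ V) :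
    h.pairing (-l) = -h.pairing l := by
  simp only [pairing, LinearMap.neg_apply, Complex.ofReal_neg]
  ring

end Algebra

section Norm

variable {V : Type*} [NormedAddCommGroup V] [NormedSpace ℝ V]

theorem continuous_im : Continuous (Complexification.im : Complexification V → V) :=
  AddMonoidHomClass.continuous_of_bound
    (⟨⟨Complexification.im, rfl⟩, fun _ _ => rfl⟩ : Complexification V →+ V) 1
    fun z => by simpa using norm_im_le z

variable [FiniteDimensional ℝ V]

instance : FiniteDimensional ℂ (Complexification V) := by
  let b := Module.finBasis ℝ V
  let e : V → Complexification V := fun v => ⟨v, 0⟩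
  refine Module.Finite.of_surjective
    (Fintype.linearCombination ℂ (fun i => e (b i))) fun z => ?_
  refine ⟨fun i => ⟨b.repr z.re i, b.repr z.im i⟩, ?_⟩
  rw [Fintype.linearCombination_apply]
  have hre : ∀ s : Finset (Fin (Module.finrank ℝ V)),
      (∑ i ∈ s, (⟨b.repr z.re i, b.repr z.im i⟩ : ℂ) • e (b i)) =
        ⟨∑ i ∈ s, b.repr z.re i • b i, ∑ i ∈ s, b.repr z.im i • b i⟩ := by
    intro s
    classical
    induction s using Finset.induction_on with
    | empty => rfl
    | insert i s hi ih =>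
      rw [Finset.sum_insert hi, ih, Finset.sum_insert hi, Finset.sum_insert hi]
      ext <;> simp [e]
  rw [hre, b.sum_repr, b.sum_repr]

instance : ProperSpace (Complexification V) := FiniteDimensional.proper ℂ _

/-- The complex-linear extension of a linear form is holomorphic. -/
theorem differentiable_pairing (l : Module.Dual ℝ V) :
    Differentiable ℂ fun h : Complexification V => h.pairing l := by
  let L : Complexification V →ₗ[ℂ] ℂ :=
    { toFun := fun h => h.pairing l
      map_add' := fun z z' => by
        simp only [pairing, add_re, add_im, map_add, Complex.ofReal_add]
        ring
      map_smul' := fun c z => by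
        apply Complex.ext <;>
          simp [pairing] }
  exact L.toContinuousLinearMap.differentiable

end Norm

end Complexification

open Filter Topology

namespace KacMoodyRootSystem

/-! ### The terms of the sum over the Weyl group -/

section Terms

variable {ι V : Type*} [AddCommGroup V] [Module ℝ V] (R : KacMoodyRootSystem ι V)

theorem norm_expPairing (h : Complexification V) (l : Module.Dual ℝ V) :
    ‖expPairing h l‖ = Real.exp (-(2 * Real.pi * l h.im)) := by
  rw [expPairing, Complex.norm_exp]
  congr 1
  simp [Complexification.pairing, Complex.mul_re, Complex.mul_im]

theorem expPairing_ne_zero (h : Complexification V) (l : Module.Dual ℝ V) :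
    expPairing h l ≠ 0 := Complex.exp_ne_zero _

theorem expPairing_neg (h : Complexification V) (l : Module.Dual ℝ V) :
    expPairing h (-l) = (expPairing h l)⁻¹ := by
  rw [expPairing, expPairing, Complexification.pairing_neg, mul_neg, Complex.exp_neg]

theorem expPairing_ne_one {h : Complexification V} {l : Module.Dual ℝ V} (hl : l h.im ≠ 0) :
    expPairing h l ≠ 1 := by
  intro h1
  have h2 := congrArg (‖·‖) h1
  simp only [norm_expPairing, norm_one, Real.exp_eq_one_iff, neg_eq_zero, mul_eq_zero,
    Real.pi_ne_zero, two_ne_zero, false_or] at h2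
  exact hl h2

theorem expPairing_map (u : R.weylGroup) (h : Complexification V) (l : Module.Dual ℝ V) :
    expPairing (h.map u) l = expPairing h (R.dualAct u⁻¹ l) := by
  simp only [expPairing, Complexification.pairing, Complexification.map, dualAct_apply, inv_inv]
  rfl

theorem factor_map (u : R.weylGroup) (t : ℂ) (h : Complexification V) (l : Module.Dual ℝ V) :
    factor t (h.map u) l = factor t h (R.dualAct u⁻¹ l) := by
  rw [factor, factor, expPairing_map]

/-- The factor of a negative coroot; no hypothesis is needed, as both denominators vanish
simultaneously. -/
theorem factor_neg (t : ℂ) (h : Complexification V) (l : Module.Dual ℝ V) :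
    factor t h (-l) = (t - expPairing h l) / (1 - expPairing h l) := by
  have h0 := expPairing_ne_zero h l
  rw [factor, expPairing_neg, ← mul_div_mul_left (1 - t * (expPairing h l)⁻¹) _ (neg_ne_zero.2 h0)]
  congr 1 <;> field_simp <;> ring

theorem weylTerm_map (u w : R.weylGroup) (t : ℂ) (h : Complexification V) :
    R.weylTerm w t (h.map u) = R.weylTerm (u⁻¹ * w) t h := by
  simp only [weylTerm, factor_map, dualAct_mul]

theorem weylSum_map (u : R.weylGroup) (t : ℂ) (h : Complexification V) :
    R.weylSum t (h.map u) = R.weylSum t h := by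
  simp only [weylSum, weylTerm_map]
  exact (Equiv.mulLeft u⁻¹).tsum_eq fun w => R.weylTerm w t h

theorem map_mem_tube (u : R.weylGroup) {h : Complexification V} (hh : h ∈ R.tube) :
    h.map u ∈ R.tube := by
  obtain ⟨w, y, hy, hw⟩ := Set.mem_iUnion.1 hh
  refine Set.mem_iUnion.2 ⟨u * w, y, hy, ?_⟩
  change (u : V ≃ₗ[ℝ] V) ((w : V ≃ₗ[ℝ] V) y) = (u : V ≃ₗ[ℝ] V) h.im
  rw [hw]

open Classical in
/-- The factor of `P_w` indexed by the positive real root `± w a`, written in terms of the coroot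
of that positive root: the sign is negative exactly for the inversions of `w`. -/
def signedFactor (w : R.weylGroup) (t : ℂ) (h : Complexification V) (b : V) : ℂ :=
  if b ∈ R.inversions w then
    (t - expPairing h (R.coroot b)) / (1 - expPairing h (R.coroot b))
  else factor t h (R.coroot b)

/-- The region of all `(t, x + iy)` with `|t| ≤ ρ` and `⟨u⁻¹ y, a_i^∨⟩ ≥ δ` for all `i`. -/
def region (u : R.weylGroup) (δ ρ : ℝ) : Set (ℂ × Complexification V) :=
  {p | ‖p.1‖ ≤ ρ ∧ ∀ i, δ ≤ R.simpleCoroot i (R.act u⁻¹ p.2.im)}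

theorem map_mem_region {u : R.weylGroup} {δ ρ : ℝ} {p : ℂ × Complexification V}
    (hp : p ∈ R.region u δ ρ) :
    (p.1, p.2.map (u⁻¹ : R.weylGroup)) ∈ R.region 1 δ ρ := by
  refine ⟨hp.1, fun i => ?_⟩
  rw [inv_one, act_one]
  exact hp.2 i

variable [Fintype ι]

open Classical in
/-- The positive one of the two roots `± w a`. -/
def absAct (w : R.weylGroup) (a : R.posRealRoots) : R.posRealRoots :=
  if h : R.act w a ∈ R.posRealRoots then ⟨R.act w a, h⟩
  else ⟨-R.act w a,
    (R.mem_or_neg_mem_posRealRoots (R.act_mem_realRoots a.2.1 w)).resolve_left h⟩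

theorem absAct_inv_absAct (w : R.weylGroup) (a : R.posRealRoots) :
    R.absAct w⁻¹ (R.absAct w a) = a := by
  apply Subtype.ext
  by_cases h : R.act w a ∈ R.posRealRoots
  · rw [absAct, absAct]
    simp [h, act_inv_act]
  · have h' : -(a : V) ∉ R.posRealRoots := R.neg_notMem_posRealRoots a.2
    rw [absAct, absAct]
    simp [h, h', act_inv_act]

/-- The permutation `a ↦ ± w a` of the positive real roots. -/
def absPerm (w : R.weylGroup) : R.posRealRoots ≃ R.posRealRoots where
  toFun := R.absAct w
  invFun := R.absAct w⁻¹
  left_inv := R.absAct_inv_absAct w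
  right_inv a := by simpa using R.absAct_inv_absAct w⁻¹ a

theorem factor_dualAct_coroot (w : R.weylGroup) (t : ℂ) (h : Complexification V)
    (a : R.posRealRoots) :
    factor t h (R.dualAct w (R.coroot a)) = R.signedFactor w t h (R.absPerm w a) := by
  have hr := R.act_mem_realRoots a.2.1 w
  rw [← R.coroot_act a.2.1]
  change _ = R.signedFactor w t h (R.absAct w a)
  by_cases hp : R.act w a ∈ R.posRealRoots
  · have hn : R.act w a ∉ R.inversions w := by
      rintro ⟨-, hn⟩
      change -R.act w⁻¹ (R.act w a) ∈ _ at hn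
      rw [act_inv_act] at hn
      exact R.neg_notMem_posRealRoots a.2 hn
    rw [absAct, dif_pos hp, signedFactor, if_neg hn]
  · have hn : -R.act w a ∈ R.inversions w := by
      refine ⟨(R.mem_or_neg_mem_posRealRoots hr).resolve_left hp, ?_⟩
      change -R.act w⁻¹ (-R.act w a) ∈ _
      rw [map_neg, neg_neg, act_inv_act]
      exact a.2
    rw [absAct, dif_neg hp, signedFactor, if_pos hn, ← factor_neg, ← R.coroot_neg
      (R.neg_mem_realRoots hr), neg_neg]

theorem weylTerm_eq_tprod_signedFactor (w : R.weylGroup) (t : ℂ) (h : Complexification V) :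
    R.weylTerm w t h = ∏' b : R.posRealRoots, R.signedFactor w t h b := by
  simp only [weylTerm, factor_dualAct_coroot]
  exact (R.absPerm w).tprod_eq fun b => R.signedFactor w t h b

end Terms

/-! ### Estimates -/

section Estimates

variable {ι V : Type*} [AddCommGroup V] [Module ℝ V] (R : KacMoodyRootSystem ι V)
  [Fintype ι]

/-- The height `∑ n_i` of the coroot `b^∨ = ∑ n_i a_i^∨` of a positive real root `b`. -/
def coheight (b : V) : ℝ := ∑ i, R.dual.coeff i (R.coroot b)

/-- The number `e^{-2πδ ht(b^∨)}`, which bounds `|e^{2πi⟨x + iy, b^∨⟩}|` if `⟨y, a_i^∨⟩ ≥ δ` for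
all `i`. -/
def rootBound (δ : ℝ) (b : V) : ℝ := Real.exp (-(2 * Real.pi * δ * R.coheight b))

theorem rootBound_pos (δ : ℝ) (b : V) : 0 < R.rootBound δ b := Real.exp_pos _

theorem mul_coheight_le {b : V} (hb : b ∈ R.posRealRoots) {δ : ℝ} {y : V}
    (hy : ∀ i, δ ≤ R.simpleCoroot i y) : δ * R.coheight b ≤ R.coroot b y := by
  have hpos := R.coroot_mem_posCone hb
  conv_rhs => rw [R.dual.eq_sum_coeff hpos]
  rw [coheight, Finset.mul_sum, LinearMap.sum_apply]
  refine Finset.sum_le_sum fun i _ => ?_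
  rw [LinearMap.smul_apply, smul_eq_mul, mul_comm]
  exact mul_le_mul_of_nonneg_left (hy i) (R.dual.coeff_nonneg hpos i)

theorem norm_expPairing_le_rootBound {b : V} (hb : b ∈ R.posRealRoots) {δ : ℝ}
    {h : Complexification V} (hy : ∀ i, δ ≤ R.simpleCoroot i h.im) :
    ‖expPairing h (R.coroot b)‖ ≤ R.rootBound δ b := by
  rw [norm_expPairing, rootBound, Real.exp_le_exp, neg_le_neg_iff, mul_assoc (2 * Real.pi)]
  exact mul_le_mul_of_nonneg_left (R.mul_coheight_le hb hy) (by positivity)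

theorem one_le_coheight {b : V} (hb : b ∈ R.posRealRoots) : 1 ≤ R.coheight b := by
  have hpos := R.coroot_mem_posCone hb
  obtain ⟨i, hi⟩ : ∃ i, R.dual.coeff i (R.coroot b) ≠ 0 := by
    by_contra! hall
    refine R.coroot_ne_zero hb.1 ?_
    rw [R.dual.eq_sum_coeff hpos]
    exact Finset.sum_eq_zero fun i _ => by rw [hall i, zero_smul]
  obtain ⟨n, hn⟩ := R.dual.exists_coeff_eq_nat hpos i
  have h1 : (1 : ℝ) ≤ R.dual.coeff i (R.coroot b) := by
    rw [hn] at hi ⊢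
    exact_mod_cast Nat.one_le_iff_ne_zero.2 (by exact_mod_cast hi)
  exact h1.trans (Finset.single_le_sum (f := fun i => R.dual.coeff i (R.coroot b))
    (fun j _ => R.dual.coeff_nonneg hpos j) (Finset.mem_univ i))

theorem coroot_apply_pos {b : V} (hb : b ∈ R.posRealRoots) {y : V} (hy : y ∈ R.chamber) :
    0 < R.coroot b y := by
  have hpos := R.coroot_mem_posCone hb
  obtain ⟨δ, hδ, hδy⟩ : ∃ δ > 0, ∀ i, δ ≤ R.simpleCoroot i y := by
    rcases isEmpty_or_nonempty ι with he | he
    · exact ⟨1, one_pos, fun i => (he.false i).elim⟩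
    · obtain ⟨i, hi⟩ := Finite.exists_min fun i => R.simpleCoroot i y
      exact ⟨_, hy i, hi⟩
  refine lt_of_lt_of_le ?_ (R.mul_coheight_le hb hδy)
  have := R.one_le_coheight hb
  positivity

/-- The numbers `rootBound δ b` are summable, because coroots are determined by their coefficients
in `ℕ`, and `∑_{n ∈ ℕ^ι} q^{∑ n_i}` is a product of geometric series. -/
theorem summable_rootBound {δ : ℝ} (hδ : 0 < δ) :
    Summable fun b : R.posRealRoots => R.rootBound δ b := by
  classical
  set q : ℝ := Real.exp (-(2 * Real.pi * δ)) with hq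
  have hq0 : 0 < q := Real.exp_pos _
  have hq1 : q < 1 := by
    rw [hq, Real.exp_lt_one_iff]
    have := Real.pi_pos
    have : 0 < 2 * Real.pi * δ := by positivity
    linarith
  choose n hn using fun (b : R.posRealRoots) (i : ι) =>
    R.dual.exists_coeff_eq_nat (R.coroot_mem_posCone b.2) i
  have hinj : Function.Injective n := by
    intro b b' h
    refine Subtype.ext (R.coroot_injOn b.2.1 b'.2.1 ?_)
    rw [R.dual.eq_sum_coeff (R.coroot_mem_posCone b.2),
      R.dual.eq_sum_coeff (R.coroot_mem_posCone b'.2)]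
    simp only [hn, h]
  have hval : ∀ b : R.posRealRoots, R.rootBound δ b = ∏ i, q ^ n b i := by
    intro b
    rw [rootBound, coheight, Finset.mul_sum, ← Finset.sum_neg_distrib, Real.exp_sum]
    refine Finset.prod_congr rfl fun i _ => ?_
    rw [hn, hq, ← Real.exp_nat_mul]
    congr 1
    ring
  refine summable_of_sum_le (c := (1 - q)⁻¹ ^ Fintype.card ι)
    (fun b => (R.rootBound_pos δ b).le) fun F => ?_
  obtain ⟨N, hN⟩ : ∃ N, ∀ b ∈ F, ∀ i, n b i < N := by
    refine ⟨(F.sup fun b => Finset.univ.sup (n b)) + 1, fun b hb i => Nat.lt_succ_of_le ?_⟩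
    exact (Finset.le_sup (f := n b) (Finset.mem_univ i)).trans
      (Finset.le_sup (f := fun b => Finset.univ.sup (n b)) hb)
  calc ∑ b ∈ F, R.rootBound δ b = ∑ m ∈ F.map ⟨n, hinj⟩, ∏ i, q ^ m i := by
        rw [Finset.sum_map]
        exact Finset.sum_congr rfl fun b _ => hval b
    _ ≤ ∑ m ∈ Fintype.piFinset fun _ : ι => Finset.range N, ∏ i, q ^ m i := by
        refine Finset.sum_le_sum_of_subset_of_nonneg (fun m hm => ?_) fun m _ _ =>
          Finset.prod_nonneg fun i _ => by positivity
        obtain ⟨b, hb, rfl⟩ := Finset.mem_map.1 hm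
        exact Fintype.mem_piFinset.2 fun i => Finset.mem_range.2 (hN b hb i)
    _ = ∏ _i : ι, ∑ k ∈ Finset.range N, q ^ k := by
        rw [Finset.prod_univ_sum]
    _ ≤ ∏ _i : ι, (1 - q)⁻¹ := by
        refine Finset.prod_le_prod (fun i _ => Finset.sum_nonneg fun k _ => by positivity)
          fun i _ => ?_
        rw [← tsum_geometric_of_lt_one hq0.le hq1]
        exact (summable_geometric_of_lt_one hq0.le hq1).sum_le_tsum _ fun k _ => by positivity
    _ = (1 - q)⁻¹ ^ Fintype.card ι := by
        rw [Finset.prod_const, Finset.card_univ]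

theorem rootBound_le {δ : ℝ} (hδ : 0 < δ) {b : V} (hb : b ∈ R.posRealRoots) :
    R.rootBound δ b ≤ Real.exp (-(2 * Real.pi * δ)) := by
  rw [rootBound, Real.exp_le_exp, neg_le_neg_iff]
  have := R.one_le_coheight hb
  exact le_mul_of_one_le_right (by positivity) this

open Classical in
/-- Estimates for the factors of `P_w` near `V + iC`. The second one has a factor `ρ` for each
inversion of `w`, and this is what produces the terms `ρ ^ ℓ(w)` of the Poincaré series. -/
theorem exists_signedFactor_bound {δ ρ : ℝ} (hδ : 0 < δ) (hρ : 0 < ρ) : ∃ M : ℝ, 0 ≤ M ∧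
    ∀ w, ∀ p ∈ R.region 1 δ ρ, ∀ b ∈ R.posRealRoots,
      ‖R.signedFactor w p.1 p.2 b - 1‖ ≤ M * (if b ∈ R.inversions w then 1 else R.rootBound δ b) ∧
      ‖R.signedFactor w p.1 p.2 b‖ ≤
        (1 + M * R.rootBound δ b) * (if b ∈ R.inversions w then ρ else 1) := by
  set q : ℝ := Real.exp (-(2 * Real.pi * δ)) with hq
  have hq1 : q < 1 := by
    rw [hq, Real.exp_lt_one_iff]
    have := Real.pi_pos
    have : 0 < 2 * Real.pi * δ := by positivity
    linarith
  set D : ℝ := (1 - q)⁻¹ with hD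
  have hq1' : 0 < 1 - q := by linarith
  have hD0 : 0 < D := inv_pos.2 hq1'
  refine ⟨(1 + ρ) * D + (1 / ρ + D + D / ρ), by positivity, ?_⟩
  rintro w ⟨t, h⟩ ⟨ht, hy⟩ b hb
  simp only [inv_one, act_one] at ht hy
  set x := R.rootBound δ b with hx
  have hx0 : 0 < x := R.rootBound_pos δ b
  have hxq : x ≤ q := R.rootBound_le hδ hb
  set e := expPairing h (R.coroot b) with he
  have hex : ‖e‖ ≤ x := R.norm_expPairing_le_rootBound hb hy
  have h1e : 1 - x ≤ ‖1 - e‖ := by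
    have := norm_sub_norm_le (1 : ℂ) e
    rw [norm_one] at this
    linarith
  have h1x : 0 < 1 - x := by linarith
  have h1e0 : 1 - e ≠ 0 := norm_pos_iff.1 (h1x.trans_le h1e)
  have h1t : ‖1 - t‖ ≤ 1 + ρ := by
    have := norm_sub_le (1 : ℂ) t
    rw [norm_one] at this
    linarith
  have hDe : ‖1 - e‖⁻¹ ≤ D := inv_anti₀ hq1' (by linarith)
  have hinv : ‖1 - e‖⁻¹ ≤ 1 + x * D := by
    have h2 : ‖1 - e‖⁻¹ ≤ (1 - x)⁻¹ := inv_anti₀ h1x h1e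
    have h3 : (1 - x)⁻¹ = 1 + x * (1 - x)⁻¹ := by
      field_simp
      ring
    have h4 : (1 - x)⁻¹ ≤ D := inv_anti₀ hq1' (by linarith)
    rw [h3] at h2
    nlinarith
  simp only [signedFactor, factor, ← he]
  split_ifs with hinv'
  · constructor
    · have h2 : (t - e) / (1 - e) - 1 = -(1 - t) * (1 - e)⁻¹ := by
        field_simp
        ring
      rw [h2, norm_mul, norm_neg, norm_inv]
      calc ‖1 - t‖ * ‖1 - e‖⁻¹ ≤ (1 + ρ) * D := by gcongr
        _ ≤ _ := by
          rw [mul_one]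
          exact le_add_of_nonneg_right (by positivity)
    · have h2 : ‖t - e‖ ≤ ρ + x := (norm_sub_le _ _).trans (add_le_add ht hex)
      rw [norm_div, div_eq_mul_inv]
      calc ‖t - e‖ * ‖1 - e‖⁻¹ ≤ (ρ + x) * (1 + x * D) := by gcongr
        _ = (1 + (1 / ρ + D + x * D / ρ) * x) * ρ := by
          field_simp
          ring
        _ ≤ (1 + ((1 + ρ) * D + (1 / ρ + D + D / ρ)) * x) * ρ := by
          have h3 : x * D / ρ ≤ D / ρ := by
            gcongr
            exact mul_le_of_le_one_left hD0.le (by linarith)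
          have h4 : 0 ≤ (1 + ρ) * D := by positivity
          have h5 : 1 / ρ + D + x * D / ρ ≤ (1 + ρ) * D + (1 / ρ + D + D / ρ) := by linarith
          exact mul_le_mul_of_nonneg_right
            (add_le_add_right (mul_le_mul_of_nonneg_right h5 hx0.le) 1) hρ.le
  · have h2 : (1 - t * e) / (1 - e) - 1 = (1 - t) * e * (1 - e)⁻¹ := by
      field_simp
      ring
    have h3 : ‖(1 - t * e) / (1 - e) - 1‖ ≤ (1 + ρ) * D * x := by
      rw [h2, norm_mul, norm_mul, norm_inv]
      calc ‖1 - t‖ * ‖e‖ * ‖1 - e‖⁻¹ ≤ (1 + ρ) * x * D := by gcongr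
        _ = (1 + ρ) * D * x := by ring
    have h4 : (1 + ρ) * D * x ≤ ((1 + ρ) * D + (1 / ρ + D + D / ρ)) * x := by
      gcongr
      exact le_add_of_nonneg_right (by positivity)
    refine ⟨h3.trans h4, ?_⟩
    have h5 := norm_add_le ((1 - t * e) / (1 - e) - 1) 1
    rw [sub_add_cancel, norm_one] at h5
    rw [mul_one]
    linarith

theorem signedFactor_bound_summable (w : R.weylGroup) {δ : ℝ} (hδ : 0 < δ) (M : ℝ)
    [DecidablePred (· ∈ R.inversions w)] :
    Summable fun b : R.posRealRoots =>
      M * (if (b : V) ∈ R.inversions w then 1 else R.rootBound δ b) := by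
  refine Summable.mul_left M ?_
  refine (R.summable_rootBound hδ).congr_cofinite ?_
  have hfin : (Subtype.val ⁻¹' R.inversions w : Set R.posRealRoots).Finite :=
    (R.finite_inversions w).preimage Subtype.val_injective.injOn
  filter_upwards [hfin.compl_mem_cofinite] with b hb
  rw [if_neg (show (b : V) ∉ R.inversions w from hb)]

/-- On a region, `P_w(t, h)` is bounded by a constant times `ρ ^ ℓ(w)`. -/
theorem exists_weylTerm_bound_one {δ ρ : ℝ} (hδ : 0 < δ) (hρ : 0 < ρ) :
    ∃ C : ℝ, ∀ w, ∀ p ∈ R.region 1 δ ρ, ‖R.weylTerm w p.1 p.2‖ ≤ C * ρ ^ R.length w := by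
  classical
  obtain ⟨M, hM, hbound⟩ := R.exists_signedFactor_bound hδ hρ
  refine ⟨Real.exp (∑' b : R.posRealRoots, M * R.rootBound δ b), fun w p hp => ?_⟩
  rw [weylTerm_eq_tprod_signedFactor]
  have hmul : Multipliable fun b : R.posRealRoots => R.signedFactor w p.1 p.2 b := by
    have h1 := multipliable_one_add_of_summable
      (f := fun b : R.posRealRoots => R.signedFactor w p.1 p.2 b - 1)
      ((R.signedFactor_bound_summable w hδ M).of_nonneg_of_le (fun b => norm_nonneg _)
        fun b => (hbound w p hp b b.2).1)
    simpa only [add_sub_cancel] using h1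
  have hfin : (Subtype.val ⁻¹' R.inversions w : Set R.posRealRoots).Finite :=
    (R.finite_inversions w).preimage Subtype.val_injective.injOn
  have hcard : hfin.toFinset.card = R.length w := by
    rw [← R.ncard_inversions w, ← Set.ncard_eq_toFinset_card _ hfin,
      Set.ncard_preimage_of_injective_subset_range Subtype.val_injective]
    rw [Subtype.range_coe]
    exact fun b hb => hb.1
  refine le_of_tendsto hmul.hasProd.norm ?_
  filter_upwards [eventually_ge_atTop hfin.toFinset] with F hF
  calc ∏ b ∈ F, ‖R.signedFactor w p.1 p.2 b‖
      ≤ ∏ b ∈ F, ((1 + M * R.rootBound δ b) * if (b : V) ∈ R.inversions w then ρ else 1) :=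
        Finset.prod_le_prod (fun b _ => norm_nonneg _) fun b _ => (hbound w p hp b b.2).2
    _ = (∏ b ∈ F, (1 + M * R.rootBound δ b)) * ρ ^ R.length w := by
        rw [Finset.prod_mul_distrib, ← hcard, ← Finset.prod_const, Finset.prod_ite,
          Finset.prod_const_one, mul_one]
        congr 2
        ext b
        simp only [Finset.mem_filter, Set.Finite.mem_toFinset, Set.mem_preimage]
        exact ⟨fun h => h.2, fun h => ⟨hF (by simpa using h), h⟩⟩
    _ ≤ Real.exp (∑' b : R.posRealRoots, M * R.rootBound δ b) * ρ ^ R.length w := by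
        gcongr
        have hx := fun b : V => R.rootBound_pos δ b
        calc ∏ b ∈ F, (1 + M * R.rootBound δ b) ≤ ∏ b ∈ F, Real.exp (M * R.rootBound δ b) := by
              refine Finset.prod_le_prod (fun b _ => ?_) fun b _ => ?_
              · have := hx b
                positivity
              · rw [add_comm]
                exact Real.add_one_le_exp _
          _ = Real.exp (∑ b ∈ F, M * R.rootBound δ b) := (Real.exp_sum _ _).symm
          _ ≤ _ := by
              rw [Real.exp_le_exp]
              refine ((R.summable_rootBound hδ).mul_left M).sum_le_tsum _ fun b _ => ?_
              have := hx b
              positivity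

/-- The bound of `P_w` near `V + i(u C)`, where `u⁻¹ w` takes the place of `w`. -/
theorem exists_weylTerm_bound (u : R.weylGroup) {δ ρ : ℝ} (hδ : 0 < δ) (hρ : 0 < ρ) :
    ∃ C : ℝ, ∀ w, ∀ p ∈ R.region u δ ρ,
      ‖R.weylTerm w p.1 p.2‖ ≤ C * ρ ^ R.length (u⁻¹ * w) := by
  obtain ⟨C, hC⟩ := R.exists_weylTerm_bound_one hδ hρ
  refine ⟨C, fun w p hp => ?_⟩
  have := hC (u⁻¹ * w) _ (R.map_mem_region hp)
  rwa [weylTerm_map, inv_inv, mul_inv_cancel_left] at this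

/-- On a region, the factors of `P_w(t, h)` differ from `1` by a summable amount. -/
theorem exists_factor_bound (u w : R.weylGroup) {δ ρ : ℝ} (hδ : 0 < δ) (hρ : 0 < ρ) :
    ∃ v : R.posRealRoots → ℝ, Summable v ∧ ∀ a : R.posRealRoots, ∀ p ∈ R.region u δ ρ,
      ‖factor p.1 p.2 (R.dualAct w (R.coroot a)) - 1‖ ≤ v a := by
  classical
  obtain ⟨M, hM, hbound⟩ := R.exists_signedFactor_bound hδ hρ
  have hs := R.signedFactor_bound_summable (u⁻¹ * w) hδ M
  refine ⟨_, (R.absPerm (u⁻¹ * w)).summable_iff.2 hs, fun a p hp => ?_⟩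
  have h1 := (hbound (u⁻¹ * w) _ (R.map_mem_region hp) _ (R.absPerm (u⁻¹ * w) a).2).1
  rw [← factor_dualAct_coroot, factor_map, inv_inv, ← dualAct_mul, mul_inv_cancel_left] at h1
  exact h1

end Estimates

/-! ### The Poincaré series -/

section Poincare

variable {ι V : Type*} [AddCommGroup V] [Module ℝ V] (R : KacMoodyRootSystem ι V)

/-- There are finitely many elements of each length, so `Nat.card` in the Poincaré series is their
actual number. -/
theorem finite_length_eq [Finite ι] (n : ℕ) : Finite {w : R.weylGroup // R.length w = n} := by
  have hfin := (List.finite_length_eq ι n).image fun L => (L.map R.gen).prod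
  refine (hfin.subset fun w hw => ?_).to_subtype
  obtain ⟨L, h1, h2⟩ := R.exists_reduced_word w
  exact ⟨L, h1.trans hw, h2⟩

/-- The terms `ρ ^ ℓ(w)` are summable within the radius of convergence of the Poincaré series. -/
theorem summable_pow_length [Finite ι] {ρ : NNReal} (hρ : (ρ : ENNReal) < R.poincareSeries.radius) :
    Summable fun w : R.weylGroup => (ρ : ℝ) ^ R.length w := by
  have hs := R.poincareSeries.summable_norm_mul_pow hρ
  simp only [poincareSeries, FormalMultilinearSeries.ofScalars_norm, Complex.norm_natCast] at hs
  rw [← (Equiv.sigmaFiberEquiv R.length).summable_iff, summable_sigma_of_nonneg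
    (fun _ => by simp only [Function.comp_apply]; positivity)]
  have hval : ∀ n (w : {w : R.weylGroup // R.length w = n}),
      ((fun w : R.weylGroup => (ρ : ℝ) ^ R.length w) ∘ Equiv.sigmaFiberEquiv R.length) ⟨n, w⟩ =
        (ρ : ℝ) ^ n := by
    rintro n ⟨w, rfl⟩
    rfl
  simp only [hval]
  have hf := R.finite_length_eq
  refine ⟨fun n => ?_, ?_⟩
  · have := hf n
    exact Summable.of_finite
  · simpa only [tsum_const, nsmul_eq_mul] using hs

theorem mem_disk_iff {t : ℂ} : t ∈ R.disk ↔ (‖t‖₊ : ENNReal) < R.poincareSeries.radius := by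
  rw [disk, Metric.mem_eball, edist_zero_right]
  rfl

/-- If the Weyl group is infinite, then its Poincaré series diverges at `1`. -/
theorem norm_lt_one_of_mem_disk [Finite ι] [Infinite R.weylGroup] {t : ℂ} (ht : t ∈ R.disk) :
    ‖t‖ < 1 := by
  by_contra hge
  have h1 : ((1 : NNReal) : ENNReal) < R.poincareSeries.radius := by
    refine lt_of_le_of_lt ?_ (R.mem_disk_iff.1 ht)
    rw [ENNReal.coe_le_coe, ← NNReal.coe_le_coe]
    exact not_lt.1 hge
  have := R.summable_pow_length h1
  simp only [NNReal.coe_one, one_pow, summable_const_iff] at this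
  exact one_ne_zero this

theorem mem_tube_iff {h : Complexification V} :
    h ∈ R.tube ↔ ∃ u : R.weylGroup, R.act u⁻¹ h.im ∈ R.chamber := by
  constructor
  · intro hh
    obtain ⟨u, y, hy, hu⟩ := Set.mem_iUnion.1 hh
    refine ⟨u, ?_⟩
    have : R.act u y = h.im := hu
    rw [← this, act_inv_act]
    exact hy
  · rintro ⟨u, hu⟩
    exact Set.mem_iUnion.2 ⟨u, _, hu, R.act_act_inv u h.im⟩

end Poincare

/-! ### Convergence, holomorphy and the factored form -/

section Analysis

variable {ι V : Type*} [NormedAddCommGroup V] [NormedSpace ℝ V] [FiniteDimensional ℝ V]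
  (R : KacMoodyRootSystem ι V)

theorem finite_index (R : KacMoodyRootSystem ι V) : Finite ι :=
  R.linearIndependent_simpleRoot.finite_of_isNoetherian

theorem continuous_simpleCoroot_act (u : R.weylGroup) (i : ι) :
    Continuous fun p : ℂ × Complexification V => R.simpleCoroot i (R.act u p.2.im) := by
  have h1 : Continuous ((R.simpleCoroot i).comp (R.act u).toLinearMap) :=
    LinearMap.continuous_of_finiteDimensional _
  exact h1.comp (Complexification.continuous_im.comp continuous_snd)

/-- The regions with `δ > 0` and `0 < ρ < r` are neighbourhoods which cover the domain. -/
theorem exists_region_mem_nhds {p : ℂ × Complexification V} (hp : p ∈ R.disk ×ˢ R.tube) :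
    ∃ (u : R.weylGroup) (δ : ℝ) (ρ : NNReal), 0 < δ ∧ 0 < ρ ∧
      (ρ : ENNReal) < R.poincareSeries.radius ∧ R.region u δ ρ ∈ 𝓝 p := by
  have := R.finite_index
  obtain ⟨ht, hh⟩ := hp
  obtain ⟨u, hu⟩ := R.mem_tube_iff.1 hh
  obtain ⟨ρ, hρt, hρ⟩ := ENNReal.lt_iff_exists_nnreal_btwn.1 (R.mem_disk_iff.1 ht)
  rw [ENNReal.coe_lt_coe] at hρt
  obtain ⟨δ, hδ, hδy⟩ : ∃ δ > 0, ∀ i, δ < R.simpleCoroot i (R.act u⁻¹ p.2.im) := by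
    rcases isEmpty_or_nonempty ι with he | he
    · exact ⟨1, one_pos, fun i => (he.false i).elim⟩
    · obtain ⟨i, hi⟩ := Finite.exists_min fun i => R.simpleCoroot i (R.act u⁻¹ p.2.im)
      exact ⟨_, half_pos (hu i), fun j => (half_lt_self (hu i)).trans_le (hi j)⟩
  refine ⟨u, δ, ρ, hδ, zero_le.trans_lt hρt, hρ, ?_⟩
  have h1 : ∀ᶠ p' : ℂ × Complexification V in 𝓝 p, ‖p'.1‖ < ρ :=
    (continuous_fst.norm.tendsto p).eventually_lt_const (by exact_mod_cast hρt)
  have h2 : ∀ᶠ p' : ℂ × Complexification V in 𝓝 p,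
      ∀ i, δ < R.simpleCoroot i (R.act u⁻¹ p'.2.im) :=
    eventually_all.2 fun i =>
      ((R.continuous_simpleCoroot_act u⁻¹ i).tendsto p).eventually_const_lt (hδy i)
  filter_upwards [h1, h2] with p' h1 h2
  exact ⟨h1.le, fun i => (h2 i).le⟩

theorem isOpen_domain : IsOpen (R.disk ×ˢ R.tube) := by
  refine Metric.isOpen_eball.prod (isOpen_iff_mem_nhds.2 fun h hh => ?_)
  have h0 : Continuous fun h : Complexification V => ((0 : ℂ), h) := by fun_prop
  have := R.finite_index
  obtain ⟨u, hu⟩ := R.mem_tube_iff.1 hh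
  have h2 : ∀ᶠ h' : Complexification V in 𝓝 h,
      ∀ i, 0 < R.simpleCoroot i (R.act u⁻¹ h'.im) :=
    eventually_all.2 fun i =>
      (((R.continuous_simpleCoroot_act u⁻¹ i).comp h0).tendsto h).eventually_const_lt (hu i)
  filter_upwards [h2] with h' h2
  exact R.mem_tube_iff.2 ⟨u, h2⟩

theorem expPairing_coroot_ne_one {h : Complexification V} (hh : h ∈ R.tube) {b : V}
    (hb : b ∈ R.realRoots) : expPairing h (R.coroot b) ≠ 1 := by
  have := R.finite_index
  have := Fintype.ofFinite ι
  obtain ⟨u, hu⟩ := R.mem_tube_iff.1 hh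
  refine expPairing_ne_one ?_
  have h1 : R.coroot b h.im = R.coroot (R.act u⁻¹ b) (R.act u⁻¹ h.im) := by
    rw [R.coroot_act hb, dualAct_apply_act]
  have hr := R.act_mem_realRoots hb u⁻¹
  rw [h1]
  rcases R.mem_or_neg_mem_posRealRoots hr with h2 | h2
  · exact (R.coroot_apply_pos h2 hu).ne'
  · have h3 := R.coroot_apply_pos h2 hu
    rw [R.coroot_neg hr, LinearMap.neg_apply] at h3
    linarith

theorem expPairing_dualAct_coroot_ne_one {h : Complexification V} (hh : h ∈ R.tube)
    (w : R.weylGroup) {a : V} (ha : a ∈ R.posRealRoots) :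
    expPairing h (R.dualAct w (R.coroot a)) ≠ 1 := by
  have := R.finite_index
  have := Fintype.ofFinite ι
  rw [← R.coroot_act ha.1]
  exact R.expPairing_coroot_ne_one hh (R.act_mem_realRoots ha.1 w)

theorem mul_expPairing_coroot_ne_one {t : ℂ} (ht : t ∈ R.disk) {h : Complexification V}
    (hh : h.im ∈ R.chamber) (hW : Infinite R.weylGroup ∨ ‖t‖ < 1) {b : V}
    (hb : b ∈ R.posRealRoots) : t * expPairing h (R.coroot b) ≠ 1 := by
  have := R.finite_index
  have := Fintype.ofFinite ι
  have ht1 : ‖t‖ < 1 := hW.elim (fun _ => R.norm_lt_one_of_mem_disk ht) id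
  have he : ‖expPairing h (R.coroot b)‖ ≤ 1 := by
    rw [norm_expPairing, Real.exp_le_one_iff, neg_nonpos]
    have := R.coroot_apply_pos hb hh
    positivity
  intro h1
  have h2 := congrArg (‖·‖) h1
  simp only [norm_mul, norm_one] at h2
  have := mul_le_of_le_one_right (norm_nonneg t) he
  linarith

theorem differentiableOn_factor {U : Set (ℂ × Complexification V)} {l : Module.Dual ℝ V}
    (hl : ∀ p ∈ U, expPairing p.2 l ≠ 1) :
    DifferentiableOn ℂ (fun p : ℂ × Complexification V => factor p.1 p.2 l) U := by
  have he : Differentiable ℂ fun p : ℂ × Complexification V => expPairing p.2 l :=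
    (((Complexification.differentiable_pairing l).comp differentiable_snd).const_mul _).cexp
  simp only [factor, div_eq_mul_inv]
  exact ((differentiable_const 1).sub (differentiable_fst.mul he)).differentiableOn.fun_mul
    (((differentiable_const 1).sub he).differentiableOn.fun_inv
      fun p hp => sub_ne_zero.2 (hl p hp).symm)

theorem exists_summable_factor_bound (w : R.weylGroup) {p : ℂ × Complexification V}
    (hp : p ∈ R.disk ×ˢ R.tube) :
    ∃ N ∈ 𝓝 p, ∃ v : R.posRealRoots → ℝ, Summable v ∧ ∀ a : R.posRealRoots, ∀ p' ∈ N,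
      ‖factor p'.1 p'.2 (R.dualAct w (R.coroot a)) - 1‖ ≤ v a := by
  have := R.finite_index
  have := Fintype.ofFinite ι
  obtain ⟨u, δ, ρ, hδ, hρ, -, hN⟩ := R.exists_region_mem_nhds hp
  exact ⟨_, hN, R.exists_factor_bound u w hδ (NNReal.coe_pos.2 hρ)⟩

theorem exists_summable_weylTerm_bound {p : ℂ × Complexification V}
    (hp : p ∈ R.disk ×ˢ R.tube) :
    ∃ N ∈ 𝓝 p, ∃ v : R.weylGroup → ℝ, Summable v ∧ ∀ w, ∀ p' ∈ N,
      ‖R.weylTerm w p'.1 p'.2‖ ≤ v w := by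
  have := R.finite_index
  have := Fintype.ofFinite ι
  obtain ⟨u, δ, ρ, hδ, hρ, hρr, hN⟩ := R.exists_region_mem_nhds hp
  obtain ⟨C, hC⟩ := R.exists_weylTerm_bound u hδ (NNReal.coe_pos.2 hρ)
  exact ⟨_, hN, _,
    ((Equiv.mulLeft u⁻¹).summable_iff.2 (R.summable_pow_length hρr)).mul_left C, hC⟩

theorem differentiableOn_weylTerm (w : R.weylGroup) :
    DifferentiableOn ℂ (fun p : ℂ × Complexification V => R.weylTerm w p.1 p.2)
      (R.disk ×ˢ R.tube) :=
  differentiableOn_tprod_of_locally_bounded R.isOpen_domain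
    (fun a => differentiableOn_factor fun _ hp => R.expPairing_dualAct_coroot_ne_one hp.2 w a.2)
    fun _ hp => R.exists_summable_factor_bound w hp

theorem differentiableOn_weylSum :
    DifferentiableOn ℂ (fun p : ℂ × Complexification V => R.weylSum p.1 p.2)
      (R.disk ×ˢ R.tube) :=
  differentiableOn_tsum_of_locally_bounded R.isOpen_domain R.differentiableOn_weylTerm
    fun _ hp => R.exists_summable_weylTerm_bound hp

theorem summable_norm_factor_sub_one {t : ℂ} (ht : t ∈ R.disk) {h : Complexification V}
    (hh : h ∈ R.tube) :
    Summable fun b : R.posRealRoots => ‖factor t h (R.coroot b) - 1‖ := by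
  obtain ⟨N, hN, v, hv, hbound⟩ := R.exists_summable_factor_bound 1 (p := (t, h)) ⟨ht, hh⟩
  simp only [dualAct_one] at hbound
  exact hv.of_nonneg_of_le (fun b => norm_nonneg _) fun b => hbound b (t, h) (mem_of_mem_nhds hN)

theorem summable_norm_weylTerm {t : ℂ} (ht : t ∈ R.disk) {h : Complexification V}
    (hh : h ∈ R.tube) : Summable fun w : R.weylGroup => ‖R.weylTerm w t h‖ := by
  obtain ⟨N, hN, v, hv, hbound⟩ := R.exists_summable_weylTerm_bound (p := (t, h)) ⟨ht, hh⟩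
  exact hv.of_nonneg_of_le (fun b => norm_nonneg _) fun b => hbound b (t, h) (mem_of_mem_nhds hN)

theorem tprod_factor_ne_zero {t : ℂ} (ht : t ∈ R.disk) {h : Complexification V}
    (hh : h ∈ R.tube) (hth : ∀ b ∈ R.posRealRoots, t * expPairing h (R.coroot b) ≠ 1) :
    ∏' b : R.posRealRoots, factor t h (R.coroot b) ≠ 0 := by
  have h1 := tprod_one_add_ne_zero_of_summable
    (f := fun b : R.posRealRoots => factor t h (R.coroot b) - 1) (fun b => ?_)
    (R.summable_norm_factor_sub_one ht hh)
  · simpa only [add_sub_cancel] using h1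
  · rw [add_sub_cancel]
    exact div_ne_zero (sub_ne_zero.2 (hth b b.2).symm)
      (sub_ne_zero.2 (R.expPairing_coroot_ne_one hh b.2.1).symm)

/-- The term of `w` in `S` is the term of `w` in the factored form times the common product:
passing from `Φ₊` to `w Φ₊` replaces the inversions of `w` by their negatives. -/
theorem weylTerm_eq_inversionTerm_mul {t : ℂ} (ht : t ∈ R.disk) {h : Complexification V}
    (hh : h ∈ R.tube) (hth : ∀ b ∈ R.posRealRoots, t * expPairing h (R.coroot b) ≠ 1)
    (w : R.weylGroup) : R.weylTerm w t h =
      R.inversionTerm w t h * ∏' b : R.posRealRoots, factor t h (R.coroot b) := by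
  classical
  have := R.finite_index
  have := Fintype.ofFinite ι
  have hfin := R.finite_inversions w
  let g : V → ℂ := fun b => if b ∈ R.inversions w then
    (t - expPairing h (R.coroot b)) / (1 - t * expPairing h (R.coroot b)) else 1
  have hg : R.inversionTerm w t h = ∏' b : R.posRealRoots, g b := by
    have hsub : Function.mulSupport g ⊆ R.posRealRoots := by
      intro b hb
      by_contra hn
      exact hb (if_neg fun h => hn h.1)
    rw [inversionTerm, finprod_mem_eq_finite_toFinset_prod _ hfin,
      tprod_subtype_eq_of_mulSupport_subset hsub, tprod_eq_prod (s := hfin.toFinset)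
        fun b hb => if_neg (by simpa using hb)]
    refine Finset.prod_congr rfl fun b hb => ?_
    exact (if_pos (by simpa using hb)).symm
  have hgm : Multipliable fun b : R.posRealRoots => g b := by
    have hfin' : (Subtype.val ⁻¹' R.inversions w : Set R.posRealRoots).Finite :=
      hfin.preimage Subtype.val_injective.injOn
    refine multipliable_of_ne_finset_one (s := hfin'.toFinset) fun b hb => if_neg ?_
    simpa using hb
  have hfm : Multipliable fun b : R.posRealRoots => factor t h (R.coroot b) := by
    have := multipliable_one_add_of_summable (R.summable_norm_factor_sub_one ht hh)
    simpa only [add_sub_cancel] using this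
  rw [weylTerm_eq_tprod_signedFactor, hg, ← hgm.tprod_mul hfm]
  refine tprod_congr fun b => ?_
  have h0 : 1 - t * expPairing h (R.coroot b) ≠ 0 := sub_ne_zero.2 (hth b b.2).symm
  simp only [signedFactor, g]
  split_ifs
  · rw [factor, div_mul_div_cancel₀ h0]
  · rw [one_mul]

theorem summable_norm_inversionTerm {t : ℂ} (ht : t ∈ R.disk) {h : Complexification V}
    (hh : h ∈ R.tube) (hth : ∀ b ∈ R.posRealRoots, t * expPairing h (R.coroot b) ≠ 1) :
    Summable fun w : R.weylGroup => ‖R.inversionTerm w t h‖ := by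
  have h0 := norm_ne_zero_iff.2 (R.tprod_factor_ne_zero ht hh hth)
  have h1 := R.summable_norm_weylTerm ht hh
  simp only [R.weylTerm_eq_inversionTerm_mul ht hh hth, norm_mul] at h1
  exact (summable_mul_right_iff h0).1 h1

theorem weylSum_eq_correction {t : ℂ} (ht : t ∈ R.disk) {h : Complexification V}
    (hh : h ∈ R.tube) (hth : ∀ b ∈ R.posRealRoots, t * expPairing h (R.coroot b) ≠ 1) :
    R.weylSum t h = R.correction t h := by
  simp only [weylSum, correction, R.weylTerm_eq_inversionTerm_mul ht hh hth, tsum_mul_right]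

end Analysis

end KacMoodyRootSystem

end

theorem corollary3p1p3 {ι V : Type*} [NormedAddCommGroup V] [NormedSpace ℝ V]
    [FiniteDimensional ℝ V] (R : KacMoodyRootSystem ι V) :
    -- the domain is open, and no denominator of the sum over the Weyl group vanishes on it
    IsOpen (R.disk ×ˢ R.tube) ∧
    (∀ h ∈ R.tube, ∀ w : R.weylGroup, ∀ a ∈ R.posRealRoots,
      KacMoodyRootSystem.expPairing h (R.dualAct w (R.coroot a)) ≠ 1) ∧
    -- each product over the positive real roots converges absolutely, uniformly on compact sets
    (∀ w : R.weylGroup, ∀ K ⊆ R.disk ×ˢ R.tube, IsCompact K →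
      SummableUniformlyOn
        (fun (a : R.posRealRoots) (p : ℂ × Complexification V) =>
          ‖KacMoodyRootSystem.factor p.1 p.2 (R.dualAct w (R.coroot a)) - 1‖) K) ∧
    -- the sum over the Weyl group converges absolutely, uniformly on compact sets
    (∀ K ⊆ R.disk ×ˢ R.tube, IsCompact K →
      SummableUniformlyOn
        (fun (w : R.weylGroup) (p : ℂ × Complexification V) => ‖R.weylTerm w p.1 p.2‖) K) ∧
    -- it equals the factored form, which converges, wherever no denominator of the latter vanishes
    (∀ t ∈ R.disk, ∀ h ∈ R.tube,
      (∀ b ∈ R.posRealRoots, t * KacMoodyRootSystem.expPairing h (R.coroot b) ≠ 1) →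
        (∀ w : R.weylGroup, (R.inversions w).Finite) ∧
        Summable (fun w : R.weylGroup => ‖R.inversionTerm w t h‖) ∧
        R.weylSum t h = R.correction t h) ∧
    -- on `V + iC` these denominators never vanish if the Weyl group is infinite or `|t| < 1`
    (∀ t ∈ R.disk, ∀ h : Complexification V, h.im ∈ R.chamber →
      (Infinite R.weylGroup ∨ ‖t‖ < 1) →
        ∀ b ∈ R.posRealRoots, t * KacMoodyRootSystem.expPairing h (R.coroot b) ≠ 1) ∧
    -- the sum is a holomorphic function on the domain, invariant under the Weyl group
    DifferentiableOn ℂ (fun p : ℂ × Complexification V => R.weylSum p.1 p.2)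
      (R.disk ×ˢ R.tube) ∧
    (∀ t ∈ R.disk, ∀ h ∈ R.tube, ∀ w : R.weylGroup,
      Complexification.map (w : V ≃ₗ[ℝ] V) h ∈ R.tube ∧
        R.weylSum t (Complexification.map (w : V ≃ₗ[ℝ] V) h) = R.weylSum t h) := by
  have := R.finite_index
  have := Fintype.ofFinite ι
  refine ⟨R.isOpen_domain, fun h hh w a ha => R.expPairing_dualAct_coroot_ne_one hh w ha,
    fun w K hKU hK => summableUniformlyOn_of_locally_bounded hK fun p hp => ?_,
    fun K hKU hK => summableUniformlyOn_of_locally_bounded hK fun p hp => ?_,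
    fun t ht h hh hth => ⟨R.finite_inversions, R.summable_norm_inversionTerm ht hh hth,
      R.weylSum_eq_correction ht hh hth⟩,
    fun t ht h hh hW b hb => R.mul_expPairing_coroot_ne_one ht hh hW hb,
    R.differentiableOn_weylSum,
    fun t _ h hh w => ⟨R.map_mem_tube w hh, R.weylSum_map w t h⟩⟩
  · simpa only [norm_norm] using R.exists_summable_factor_bound w (hKU hp)
  · simpa only [norm_norm] using R.exists_summable_weylTerm_bound (hKU hp)
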